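/- Work in $L^2(\mathbb R)$ with translations $T_af(t)=f(t-a)$ and modulations $M_\xi f(t)=e^{2\pi i\xi t}f(t)$; $\operatorname{supp}$ denotes the (closed) essential support, $f|_I$ is $f$ on $I$ and $0$ elsewhere, intervals $[x,y]$ with $x>y$ are empty, and $\mathbb N=\{1,2,\dots\}$. Let $g_n\in L^2(\mathbb R)$, $b_n>0$ $(n\in\mathbb Z)$ be such that the nonstationary Gabor system $g_{m,n}=M_{mb_n}g_n$, $m,n\in\mathbb Z$, is a frame for $L^2(\mathbb R)$. Let $\operatorname{supp}(g_n)=[c_n,d_n]$ with $c_n<d_n$ and $b_n>\frac1{d_n-c_n}$ for all $n$, and suppose that for some $\epsilon>0$ and all $n\in\mathbb Z$ $$d_{n-1}\le c_{n+1},\qquad b_n^{-1}\ge\max\Big\{\tfrac{d_n-c_n}{2},\;c_{n+1}-c_n,\;d_n-d_{n-1}\Big\}+\epsilon .$$ For $n\in\mathbb Z$, $k\in\mathbb N$ put $B^{+}_{n,k}=\sum_{j=0}^{k-1}b_{n+j}^{-1}$, $B^{-}_{n,k}=\sum_{j=0}^{k-1}b_{n-j}^{-1}$ and $$I_{n,0}=[c_n,d_n],\qquad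 I^+_{n,k}=[c_{n-k+1}+B^-_{n,k},\,d_n],\qquad I^-_{n,k}=[c_n,\,d_{n+k-1}-B^+_{n,k}].$$ Then the frame operator $Sf=\sum_{m,n}\langle f,g_{m,n}\rangle g_{m,n}$ is a well-defined bounded operator with bounded inverse, and, with $\widetilde{g_{m,n}}=S^{-1}g_{m,n}$ the canonical dual elements, the following hold. (i) There are $\omega_0,\omega_{n,k}\in L^\infty(\mathbb R)$ $(n\in\mathbb Z,\ k\in\mathbb Z\setminus\{0\})$ with $\operatorname{supp}(\omega_{n,k})\subseteq I^{-\operatorname{sgn}(k)}_{n,|k|}$ such that $$S^{-1}f=\omega_0f+\sum_{n\in\mathbb Z}\sum_{k\in\mathbb Z\setminus\{0\}}\omega_{n,k}\,T_{-\operatorname{sgn}(k)B^{\operatorname{sgn}(k)}_{n,|k|}}f\qquad\text{for all }f\in L^2(\mathbb R),$$ with unconditional convergence in $L^2(\mathbb R)$. (ii) For all $m,n\in\mathbb Z$, $\operatorname{supp}(\widetilde{g_{m,n}})\subseteq I_{n,0}\cup\bigcup_{k\in\mathbb N}\big(I^-_{n-k,k}\cup I^+_{n+k,k}\big)$. (iii)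 For all $m,n\in\mathbb Z$ (the series converging in $L^2(\mathbb R)$), $$\widetilde{g_{m,n}}=M_{mb_n}\Big(\widetilde{g_{0,n}}|_{I_{n,0}}+\sum_{k\in\mathbb N}\big(e^{2\pi i m b_nB^+_{n-k,k}}\,\widetilde{g_{0,n}}|_{I^-_{n-k,k}}+e^{-2\pi i m b_nB^-_{n+k,k}}\,\widetilde{g_{0,n}}|_{I^+_{n+k,k}}\big)\Big).$$ (iv) For each $n\in\mathbb Z$ there is $k_n\in\mathbb N$ with $I^\pm_{n,k}=\emptyset$ for all $k\ge k_n$. If moreover $d_n-c_n-b_n^{-1}\le C<\infty$ for all $n\in\mathbb Z$, then for all $n\in\mathbb Z$ and $k\in\mathbb N$: $I^\pm_{n,k}=\emptyset$ whenever $k>C/\epsilon+1$, and $I^\pm_{n,k}$ contains at most one point whenever $k\ge C/\epsilon+1$. -/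

import Mathlib

open MeasureTheory Topology
open scoped ENNReal

noncomputable section

namespace NSGabor

/-- The Hilbert space `L²(ℝ)` of complex-valued functions. -/
abbrev L2 : Type := Lp ℂ 2 (volume : Measure ℝ)

/-- The space `L^∞(ℝ)` of complex-valued functions. Its elements act on `L²(ℝ)` by pointwise
multiplication, written `ω • f`. -/
abbrev Linf : Type := Lp ℂ ∞ (volume : Measure ℝ)

/-- The essential support of a function: the complement of the largest open set on which
the function vanishes almost everywhere. -/
def essSupport (f : ℝ → ℂ) : Set ℝ :=
  {x | ∀ U : Set ℝ, IsOpen U → x ∈ U → ¬ (∀ᵐ t ∂(volume.restrict U), f t = 0)}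

/-- The translation operator `(T_a f)(t) = f (t - a)` on `L²(ℝ)`. -/
def translation (a : ℝ) : L2 →ₗᵢ[ℂ] L2 :=
  Lp.compMeasurePreservingₗᵢ ℂ (fun t : ℝ => t - a) (measurePreserving_sub_right volume a)

/-- The character `t ↦ exp (2 π i ξ t)`. -/
def character (ξ : ℝ) (t : ℝ) : ℂ := Complex.exp (2 * Real.pi * Complex.I * ξ * t)

theorem memLp_character (ξ : ℝ) : MemLp (character ξ) ∞ (volume : Measure ℝ) := by
  have hc : Continuous (character ξ) := by unfold character; fun_prop
  refine memLp_top_of_bound hc.aestronglyMeasurable 1 (Filter.Eventually.of_forall fun t => ?_)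
  have h : 2 * Real.pi * Complex.I * (ξ : ℂ) * (t : ℂ)
      = ((2 * Real.pi * ξ * t : ℝ) : ℂ) * Complex.I := by push_cast; ring
  rw [character, h, Complex.norm_exp_ofReal_mul_I]

/-- The modulation operator `(M_ξ f)(t) = exp (2 π i ξ t) f(t)` on `L²(ℝ)`. -/
def modulation (ξ : ℝ) (f : L2) : L2 :=
  (memLp_character ξ).toLp (character ξ) • f

/-- The restriction `f|_I`, extended by zero outside the measurable set `I`. -/
def restriction (I : Set ℝ) (hI : MeasurableSet I) (f : L2) : L2 :=
  ((Lp.memLp f).indicator hI).toLp (I.indicator f)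

/-- `φ` is a frame for the Hilbert space `H`. Mathlib's inner product is conjugate-linear in its
first argument, so `⟨f, φ_l⟩` is written `inner ℂ (φ l) f`. -/
def IsFrame {Λ H : Type*} [NormedAddCommGroup H] [InnerProductSpace ℂ H] (φ : Λ → H) : Prop :=
  ∃ A B : ℝ, 0 < A ∧ A ≤ B ∧ ∀ f : H,
    Summable (fun l => ‖inner ℂ (φ l) f‖ ^ 2) ∧
    A * ‖f‖ ^ 2 ≤ ∑' l, ‖inner ℂ (φ l) f‖ ^ 2 ∧
    ∑' l, ‖inner ℂ (φ l) f‖ ^ 2 ≤ B * ‖f‖ ^ 2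

/-- `S` is the frame operator `S f = ∑ l, ⟨f, φ_l⟩ φ_l`, with unconditional convergence
in norm. -/
def IsFrameOperator {Λ H : Type*} [NormedAddCommGroup H] [InnerProductSpace ℂ H]
    (φ : Λ → H) (S : H →L[ℂ] H) : Prop :=
  ∀ f : H, HasSum (fun l => inner ℂ (φ l) f • φ l) (S f)

/-- The nonstationary Gabor system `g_{m,n} = M_{m b_n} g_n`, indexed by `(m, n)`. -/
def gaborSystem (g : ℤ → L2) (b : ℤ → ℝ) (p : ℤ × ℤ) : L2 :=
  modulation (p.1 * b p.2) (g p.2)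

/-- `W` has on the dense subspace `X` the Walnut-like representation
`W f = ∑ l, ω_l T_{a_l} f` (unconditionally convergent in `L²(ℝ)`) with weights `ω` and
translation constants `a`. -/
def IsWalnutLikeRepresentation {Λ : Type*} [Countable Λ] (X : Submodule ℂ L2) (W : L2 →L[ℂ] L2)
    (ω : Λ → Linf) (a : Λ → ℝ) : Prop :=
  Dense (X : Set L2) ∧
    ∀ f ∈ X, HasSum (fun l => (ω l • translation (a l) f : L2)) (W f)

/-- `B⁺_{n,k} = ∑_{j=0}^{k-1} 1 / b_{n+j}`. -/
def Bplus (b : ℤ → ℝ) (n : ℤ) (k : ℕ) : ℝ := ∑ j ∈ Finset.range k, (b (n + j))⁻¹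

/-- `B⁻_{n,k} = ∑_{j=0}^{k-1} 1 / b_{n-j}`. -/
def Bminus (b : ℤ → ℝ) (n : ℤ) (k : ℕ) : ℝ := ∑ j ∈ Finset.range k, (b (n - j))⁻¹

/-- `I_{n,0} = [c_n, d_n]`. -/
def Izero (c d : ℤ → ℝ) (n : ℤ) : Set ℝ := Set.Icc (c n) (d n)

/-- `I⁺_{n,k} = [c_{n-k+1} + B⁻_{n,k}, d_n]`, meant for `k ≥ 1`
(empty if the left end exceeds the right end). -/
def Iplus (b c d : ℤ → ℝ) (n : ℤ) (k : ℕ) : Set ℝ :=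
  Set.Icc (c (n - k + 1) + Bminus b n k) (d n)

/-- `I⁻_{n,k} = [c_n, d_{n+k-1} - B⁺_{n,k}]`, meant for `k ≥ 1`
(empty if the left end exceeds the right end). -/
def Iminus (b c d : ℤ → ℝ) (n : ℤ) (k : ℕ) : Set ℝ :=
  Set.Icc (c n) (d (n + k - 1) - Bplus b n k)

theorem measurableSet_Izero (c d : ℤ → ℝ) (n : ℤ) : MeasurableSet (Izero c d n) :=
  measurableSet_Icc

theorem measurableSet_Iplus (b c d : ℤ → ℝ) (n : ℤ) (k : ℕ) : MeasurableSet (Iplus b c d n k) :=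
  measurableSet_Icc

theorem measurableSet_Iminus (b c d : ℤ → ℝ) (n : ℤ) (k : ℕ) : MeasurableSet (Iminus b c d n k) :=
  measurableSet_Icc

/-- The pairs `(n, k)` of integers with `k ≠ 0`. -/
abbrev OffDiag : Type := {p : ℤ × ℤ // p.2 ≠ 0}

/-- The translation constant `-sgn(k) B^{sgn(k)}_{n,|k|}` for `k ≠ 0`. -/
def walnutShift (b : ℤ → ℝ) (p : OffDiag) : ℝ :=
  if 0 < p.1.2 then -Bplus b p.1.1 p.1.2.natAbs else Bminus b p.1.1 p.1.2.natAbs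

/-- The interval `I^{-sgn(k)}_{n,|k|}` for `k ≠ 0`. -/
def walnutInterval (b c d : ℤ → ℝ) (p : OffDiag) : Set ℝ :=
  if 0 < p.1.2 then Iminus b c d p.1.1 p.1.2.natAbs else Iplus b c d p.1.1 p.1.2.natAbs

/-- The `k`-th term (`k ≥ 1`)
`f|_{I⁻_{n-k,k}} exp(2πi m b_n B⁺_{n-k,k}) + f|_{I⁺_{n+k,k}} exp(-2πi m b_n B⁻_{n+k,k})`. -/
def phaseTerm (b c d : ℤ → ℝ) (m n : ℤ) (f : L2) (k : ℕ+) : L2 :=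
  Complex.exp (2 * Real.pi * Complex.I * m * b n * Bplus b (n - (k : ℕ)) k) •
      restriction (Iminus b c d (n - (k : ℕ)) k) (measurableSet_Iminus b c d (n - (k : ℕ)) k) f +
    Complex.exp (-(2 * Real.pi * Complex.I * m * b n * Bminus b (n + (k : ℕ)) k)) •
      restriction (Iplus b c d (n + (k : ℕ)) k) (measurableSet_Iplus b c d (n + (k : ℕ)) k) f

end NSGabor

end

/-! Cut the line into the slots [c_m, c_{m+1}). Since d_n ≤ c_{n+2}, each g_{m,n} lives on the slots
n and n+1, so S is tridiagonal with respect to the slot projections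
(`Geometry.frameOperator_tridiagonal`). As S is coercive, S⁻¹ is a Neumann series in the tridiagonal
contraction 1 - τS. The j-th power has bandwidth j, so the blocks of S⁻¹ decay exponentially off the
diagonal (`norm_neumann_block_le`), and S⁻¹ is the unconditional sum of its blocks
(`hasSum_blocks`).

The form of the blocks comes from a commutant. The n-th part of S commutes with 1/b_n-periodic
multipliers and lives on an interval shorter than 2/b_n. Hence S, and with it S⁻¹, commutes with
every bounded measurable φ such that φ(t + 1/b_n) = φ(t) whenever both points lie in (c_n, d_n)
(`Geometry.frameOperator_commute`). Write σ for `totalShift`, so that σ(n+1) - σ(n) = 1/b_n, and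
u(t) = t - σ(m) for t in slot m (`unshifted`). Every function of u is such a φ. So each block,
composed with the right translation, commutes with all bounded multipliers and is therefore a
multiplier (`exists_symbol`).

The slots m and m+1 are linked only for u between c_m - σ(m) and d_m - σ(m+1). Both ends drop by at
least ε when m grows by 1, so a chain joins the slots n and n+k only for u between c_n - σ(n) and
d_{n+k-1} - σ(n+k). The intervals I± are these ranges read in the coordinate t. The indicator of the
part of the chains on one side of a missing link is again an admissible φ, and this confines the
symbols and the dual elements to the I±; the loss of ε per link gives (iv).

For (iii), on the support of g_n the character of frequency m b_n agrees with a function θ of u.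
Thus S⁻¹g_{m,n} = θ S⁻¹g_{0,n}, and on each interval θ is the modulation times a constant phase. -/

noncomputable section

namespace NSGabor

/-! ### Frame operators and the Neumann series of a coercive operator. -/

section FrameOperator

variable {Λ H : Type*} [NormedAddCommGroup H] [InnerProductSpace ℂ H]

/-- A family satisfying the upper frame inequality has a frame operator. -/
theorem exists_isFrameOperator [CompleteSpace H] {φ : Λ → H} {B : ℝ}
    (hs : ∀ f, Summable fun l => ‖inner ℂ (φ l) f‖ ^ 2)
    (hB : ∀ f, ∑' l, ‖inner ℂ (φ l) f‖ ^ 2 ≤ B * ‖f‖ ^ 2) :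
    ∃ S : H →L[ℂ] H, IsFrameOperator φ S := by
  classical
  have hmem : ∀ f, Memℓp (fun l => inner ℂ (φ l) f) 2 := fun f =>
    memℓp_gen (by simpa using hs f)
  let T₀ : H →ₗ[ℂ] lp (fun _ : Λ => ℂ) 2 :=
    { toFun := fun f => ⟨fun l => inner ℂ (φ l) f, hmem f⟩
      map_add' := fun f g => by ext l; exact inner_add_right _ _ _
      map_smul' := fun a f => by ext l; exact inner_smul_right _ _ _ }
  have hT₀ : ∀ f, ‖T₀ f‖ ≤ √(max B 0) * ‖f‖ := fun f => by
    have h1 : ‖T₀ f‖ ^ 2 = ∑' l, ‖inner ℂ (φ l) f‖ ^ 2 := by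
      have := lp.norm_rpow_eq_tsum (p := 2) (by norm_num) (T₀ f)
      simpa [T₀] using this
    have h2 : ‖T₀ f‖ ^ 2 ≤ (√(max B 0) * ‖f‖) ^ 2 := by
      rw [h1, mul_pow, Real.sq_sqrt (le_max_right _ _)]
      exact (hB f).trans (by gcongr; exact le_max_left _ _)
    exact le_of_sq_le_sq h2 (by positivity)
  let T : H →L[ℂ] lp (fun _ : Λ => ℂ) 2 := T₀.mkContinuous _ hT₀
  -- With T the analysis operator, S = T*T; the series for S f is T* applied to the expansion of T f
  -- in unit vectors.
  refine ⟨T.adjoint ∘L T, fun f => ?_⟩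
  have h := (lp.hasSum_single (p := 2) (by norm_num) (T f)).mapL T.adjoint
  refine h.congr_fun fun l => ?_
  refine ext_inner_left ℂ fun v => ?_
  rw [ContinuousLinearMap.adjoint_inner_right, lp.inner_single_right, inner_smul_right]
  simp [T, T₀, mul_comm]

variable {φ : Λ → H} {S : H →L[ℂ] H}

theorem IsFrameOperator.hasSum_inner (hS : IsFrameOperator φ S) (f h : H) :
    HasSum (fun l => inner ℂ (φ l) f * inner ℂ h (φ l)) (inner ℂ h (S f)) := by
  have := (hS f).mapL (innerSL ℂ h)
  simpa [inner_smul_right] using this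

theorem IsFrameOperator.tsum_eq_re_inner (hS : IsFrameOperator φ S) (f : H) :
    ∑' l, ‖inner ℂ (φ l) f‖ ^ 2 = RCLike.re (inner ℂ f (S f)) := by
  have h := (hS.hasSum_inner f f).mapL (RCLike.reCLM (K := ℂ))
  refine HasSum.tsum_eq (h.congr_fun fun l => ?_)
  rw [← inner_conj_symm f (φ l), RCLike.reCLM_apply, RCLike.mul_conj]
  norm_cast

/-- A coercive bounded operator is invertible and its inverse is a Neumann series. -/
theorem exists_neumann_series [CompleteSpace H] {S : H →L[ℂ] H} {A : ℝ} (hA : 0 < A)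
    (h : ∀ f, A * ‖f‖ ^ 2 ≤ RCLike.re (inner ℂ f (S f))) :
    ∃ (e : H ≃L[ℂ] H) (τ : ℂ), (e : H →L[ℂ] H) = S ∧ ‖1 - τ • S‖ < 1 ∧
      HasSum (fun j : ℕ => τ • (1 - τ • S) ^ j) (e.symm : H →L[ℂ] H) := by
  set M : ℝ := max A ‖S‖ + 1 with hM
  have hM0 : 0 < M := by positivity
  have hAM : A < M := by have := le_max_left A ‖S‖; linarith
  have hSM : ‖S‖ ≤ M := by have := le_max_right A ‖S‖; linarith
  -- ‖f - tSf‖² ≤ (1 - 2tA + t²M²)‖f‖², and this t minimises the factor, with value 1 - A²/M².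
  -- Taking M ≥ A keeps that value nonnegative.
  set t : ℝ := A / M ^ 2 with ht
  have ht0 : 0 < t := by positivity
  have hkey : ∀ f, ‖(1 - (t : ℂ) • S) f‖ ^ 2 ≤ (1 - A ^ 2 / M ^ 2) * ‖f‖ ^ 2 := fun f => by
    have e1 : ‖(1 - (t : ℂ) • S) f‖ ^ 2
        = ‖f‖ ^ 2 - 2 * (t * RCLike.re (inner ℂ f (S f))) + t ^ 2 * ‖S f‖ ^ 2 := by
      have := @norm_sub_sq ℂ H _ _ _ f ((t : ℂ) • S f)
      simp only [sub_apply, one_apply_eq_self, smul_apply]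
      rw [this, inner_smul_right, norm_smul, mul_pow]
      simp [abs_of_pos ht0]
    have e2 : ‖S f‖ ^ 2 ≤ M ^ 2 * ‖f‖ ^ 2 := by
      rw [← mul_pow]
      exact pow_le_pow_left₀ (norm_nonneg _) ((S.le_opNorm f).trans (by gcongr)) 2
    have e3 := h f
    have e4 : t * M ^ 2 = A := by rw [ht]; field_simp
    have e5 : A ^ 2 / M ^ 2 = t * A := by rw [ht]; field_simp
    rw [e1, e5]
    have e6 : t * (A * ‖f‖ ^ 2) ≤ t * RCLike.re (inner ℂ f (S f)) := by gcongr
    have e7 : t ^ 2 * ‖S f‖ ^ 2 ≤ t * A * ‖f‖ ^ 2 := by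
      calc t ^ 2 * ‖S f‖ ^ 2 ≤ t ^ 2 * (M ^ 2 * ‖f‖ ^ 2) := by gcongr
        _ = t * (t * M ^ 2) * ‖f‖ ^ 2 := by ring
        _ = _ := by rw [e4]
    linarith
  have hq0 : 0 ≤ 1 - A ^ 2 / M ^ 2 := by
    rw [sub_nonneg, div_le_one (by positivity)]
    gcongr
  have hq1 : √(1 - A ^ 2 / M ^ 2) < 1 := by
    rw [Real.sqrt_lt' one_pos]
    have : 0 < A ^ 2 / M ^ 2 := by positivity
    linarith
  have hR : ‖1 - (t : ℂ) • S‖ < 1 := by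
    refine lt_of_le_of_lt
      (ContinuousLinearMap.opNorm_le_bound _ (Real.sqrt_nonneg _) fun f => ?_) hq1
    refine le_of_sq_le_sq ?_ (by positivity)
    simpa only [mul_pow, Real.sq_sqrt hq0] using hkey f
  have htc : (t : ℂ) ≠ 0 := by exact_mod_cast ht0.ne'
  set R := 1 - (t : ℂ) • S with hRdef
  have hsum := (summable_norm_geometric_of_norm_lt_one hR).of_norm.hasSum
  have hSR : (t : ℂ) • S = 1 - R := by rw [hRdef]; abel
  set N := ∑' j, R ^ j with hN
  have h1 : S * ((t : ℂ) • N) = 1 := by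
    rw [mul_smul_comm, ← smul_mul_assoc, hSR]
    exact mul_neg_geom_series R hR
  have h2 : ((t : ℂ) • N) * S = 1 := by
    rw [smul_mul_assoc, ← mul_smul_comm, hSR]
    exact geom_series_mul_neg R hR
  refine ⟨ContinuousLinearEquiv.equivOfInverse S ((t : ℂ) • N)
    (fun x => by simpa using congrArg (fun T : H →L[ℂ] H => T x) h2)
    (fun x => by simpa using congrArg (fun T : H →L[ℂ] H => T x) h1), t, ?_, hR, ?_⟩
  · ext; rfl
  · have : ((ContinuousLinearEquiv.equivOfInverse S ((t : ℂ) • N)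
      (fun x => by simpa using congrArg (fun T : H →L[ℂ] H => T x) h2)
      (fun x => by simpa using congrArg (fun T : H →L[ℂ] H => T x) h1)).symm : H →L[ℂ] H)
        = (t : ℂ) • N := by ext; rfl
    rw [this]
    exact hsum.const_smul _

end FrameOperator

/-! ### Block decompositions of operators and off-diagonal decay. -/

section

theorem summable_pow_natAbs {q : ℝ} (h0 : 0 ≤ q) (h1 : q < 1) (K : ℝ) :
    Summable fun k : ℤ => K * q ^ k.natAbs := by
  refine Summable.mul_left _ (Summable.of_nat_of_neg ?_ ?_) <;>
    simpa using summable_geometric_of_lt_one h0 h1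

section Partition

variable {H : Type*} [NormedAddCommGroup H] [InnerProductSpace ℂ H]

/-- Mutually orthogonal projections summing strongly to the identity. -/
structure IsOrthogonalPartition (P : ℤ → H →L[ℂ] H) : Prop where
  proj : ∀ o x, P o (P o x) = P o x
  orth : ∀ o i, o ≠ i → ∀ x, P o (P i x) = 0
  symm : ∀ o x y, inner ℂ (P o x) y = inner ℂ x (P o y)
  hasSum : ∀ x, HasSum (fun o => P o x) x

namespace IsOrthogonalPartition

variable {P : ℤ → H →L[ℂ] H} (hP : IsOrthogonalPartition P)
include hP

theorem inner_eq_zero {o i : ℤ} (h : o ≠ i) (x y : H) : inner ℂ (P o x) (P i y) = 0 := by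
  rw [hP.symm, hP.orth o i h, inner_zero_right]

theorem norm_sum_sq {α : Type*} (G : Finset α) (o : α → ℤ) (ho : Set.InjOn o G) (x : α → H) :
    ‖∑ a ∈ G, P (o a) (x a)‖ ^ 2 = ∑ a ∈ G, ‖P (o a) (x a)‖ ^ 2 := by
  classical
  induction G using Finset.induction_on with
  | empty => simp
  | insert a G ha ih =>
    have hz : inner ℂ (P (o a) (x a)) (∑ a ∈ G, P (o a) (x a)) = 0 := by
      rw [inner_sum]
      refine Finset.sum_eq_zero fun b hb => hP.inner_eq_zero (fun hab => ha ?_) _ _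
      rwa [ho (by simp) (by simp [hb]) hab]
    rw [Finset.sum_insert ha, Finset.sum_insert ha,
      ← ih (ho.mono (by simp)), sq, norm_add_sq_eq_norm_sq_add_norm_sq_of_inner_eq_zero _ _ hz, sq,
      sq]

theorem sum_norm_sq_le {α : Type*} (G : Finset α) (o : α → ℤ) (ho : Set.InjOn o G) (x : H) :
    ∑ a ∈ G, ‖P (o a) x‖ ^ 2 ≤ ‖x‖ ^ 2 := by
  have h1 := hP.norm_sum_sq G o ho fun _ => x
  set y := ∑ a ∈ G, P (o a) x with hy
  have h2 : ‖y‖ ^ 2 = RCLike.re (inner ℂ y x) := by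
    rw [h1, hy, sum_inner, map_sum]
    refine Finset.sum_congr rfl fun a _ => ?_
    rw [← hP.proj, hP.symm, hP.proj, ← norm_sq_eq_re_inner (𝕜 := ℂ)]
  have h3 : ‖y‖ ^ 2 ≤ ‖y‖ * ‖x‖ := h2.le.trans (re_inner_le_norm _ _)
  have h4 : ‖y‖ ≤ ‖x‖ := by
    by_contra! h
    nlinarith [norm_nonneg x]
  rw [← h1]
  gcongr

theorem norm_apply_le (o : ℤ) (x : H) : ‖P o x‖ ≤ ‖x‖ := by
  have := hP.sum_norm_sq_le {()} (fun _ => o) (by simp) x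
  exact le_of_sq_le_sq (by simpa using this) (norm_nonneg _)

/-- The finite sums of the blocks of an operator are bounded if the diagonals are summable. -/
theorem norm_sum_blocks_le {W : H →L[ℂ] H} {δ : ℤ → ℝ} (hδ : Summable δ)
    (hW : ∀ o i x, ‖P o (W (P i x))‖ ≤ δ (i - o) * ‖x‖) (F : Finset (ℤ × ℤ)) (x : H) :
    ‖∑ p ∈ F, P p.1 (W (P p.2 x))‖ ≤ (∑' k, |δ k|) * ‖x‖ := by
  classical
  -- Group the blocks by the diagonal k = i - o. On one diagonal both the outputs and the inputs
  -- belong to distinct orthogonal ranges, so by Pythagoras that diagonal has norm at most |δ k|.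
  rw [← Finset.sum_fiberwise_of_maps_to (t := F.image fun p => p.2 - p.1)
    (g := fun p => p.2 - p.1) (fun p hp => Finset.mem_image_of_mem _ hp)]
  refine (norm_sum_le _ _).trans ?_
  refine le_trans ?_ (mul_le_mul_of_nonneg_right
    (hδ.abs.sum_le_tsum (F.image fun p => p.2 - p.1) fun k _ => abs_nonneg _) (norm_nonneg x))
  rw [Finset.sum_mul]
  refine Finset.sum_le_sum fun k _ => le_of_sq_le_sq ?_ (by positivity)
  have hinj : Set.InjOn (Prod.fst : ℤ × ℤ → ℤ) (F.filter fun p => p.2 - p.1 = k) := by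
    rintro ⟨a, b⟩ ha ⟨a', b'⟩ hb hab
    simp only [Finset.coe_filter, Set.mem_ofPred_eq] at ha hb hab
    ext <;> grind
  have hinj' : Set.InjOn (Prod.snd : ℤ × ℤ → ℤ) (F.filter fun p => p.2 - p.1 = k) := by
    rintro ⟨a, b⟩ ha ⟨a', b'⟩ hb hab
    simp only [Finset.coe_filter, Set.mem_ofPred_eq] at ha hb hab
    ext <;> grind
  rw [hP.norm_sum_sq _ _ hinj, mul_pow]
  calc ∑ p ∈ F with p.2 - p.1 = k, ‖P p.1 (W (P p.2 x))‖ ^ 2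
      ≤ ∑ p ∈ F with p.2 - p.1 = k, |δ k| ^ 2 * ‖P p.2 x‖ ^ 2 := by
        refine Finset.sum_le_sum fun p hp => ?_
        rw [← mul_pow]
        refine pow_le_pow_left₀ (norm_nonneg _) ?_ 2
        have := hW p.1 p.2 (P p.2 x)
        rw [hP.proj, (Finset.mem_filter.1 hp).2] at this
        exact this.trans (by gcongr; exact le_abs_self _)
    _ ≤ |δ k| ^ 2 * ‖x‖ ^ 2 := by
        rw [← Finset.mul_sum]
        gcongr
        exact hP.sum_norm_sq_le _ _ hinj' x

/-- An operator with summable diagonals is the unconditional sum of its blocks. -/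
theorem hasSum_blocks {W : H →L[ℂ] H} {δ : ℤ → ℝ} (hδ : Summable δ)
    (hW : ∀ o i x, ‖P o (W (P i x))‖ ≤ δ (i - o) * ‖x‖) (x : H) :
    HasSum (fun p : ℤ × ℤ => P p.1 (W (P p.2 x))) (W x) := by
  have h1 : ∀ i x, HasSum (fun p : ℤ × ℤ => P p.1 (W (P p.2 (P i x)))) (W (P i x)) := by
    intro i x
    have hinj : Function.Injective fun o : ℤ => (o, i) := fun a b hab => (Prod.ext_iff.1 hab).1
    rw [← hinj.hasSum_iff]
    · refine (hP.hasSum (W (P i x))).congr_fun fun o => ?_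
      simp [hP.proj]
    · rintro ⟨o, j⟩ hj
      have : j ≠ i := fun h => hj ⟨o, by rw [h]⟩
      simp [hP.orth j i this]
  have h2 : ∀ G : Finset ℤ, HasSum (fun p : ℤ × ℤ => P p.1 (W (P p.2 (∑ i ∈ G, P i x))))
      (W (∑ i ∈ G, P i x)) := by
    intro G
    simp only [map_sum]
    exact hasSum_sum fun i _ => h1 i x
  set K := (∑' k, |δ k|) with hK
  have hK0 : 0 ≤ K := tsum_nonneg fun _ => abs_nonneg _
  -- The finite block sums are bounded by K uniformly in the finite set, so convergence passes from
  -- the partial sums y, for which it is known, to their limit x.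
  rw [HasSum, Metric.tendsto_nhds]
  intro r hr
  have hden : 0 < K + ‖W‖ + 1 := by positivity
  obtain ⟨G, hG⟩ := ((Metric.tendsto_nhds.1 (hP.hasSum x) _
    (div_pos (half_pos hr) hden))).exists
  set y := ∑ i ∈ G, P i x with hy
  rw [dist_eq_norm, ← norm_neg, neg_sub, lt_div_iff₀ hden] at hG
  filter_upwards [Metric.tendsto_nhds.1 (h2 G) _ (half_pos hr)] with F hF
  rw [dist_eq_norm] at hF ⊢
  have e : ∑ p ∈ F, P p.1 (W (P p.2 x)) - W x = ∑ p ∈ F, P p.1 (W (P p.2 (x - y)))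
      + (∑ p ∈ F, P p.1 (W (P p.2 y)) - W y) - W (x - y) := by
    simp only [map_sub, Finset.sum_sub_distrib]; abel
  have b1 := hP.norm_sum_blocks_le hδ hW F (x - y)
  have b2 := W.le_opNorm (x - y)
  rw [e]
  calc _ ≤ K * ‖x - y‖ + ‖∑ p ∈ F, P p.1 (W (P p.2 y)) - W y‖ + ‖W‖ * ‖x - y‖ :=
        (norm_sub_le _ _).trans (add_le_add ((norm_add_le _ _).trans (by gcongr)) b2)
    _ < r := by nlinarith [norm_nonneg (x - y)]

/-- The powers of a tridiagonal operator are banded. -/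
theorem pow_banded {R : H →L[ℂ] H} (hR : ∀ o i : ℤ, 1 < |o - i| → ∀ x, P o (R (P i x)) = 0)
    (j : ℕ) (o i : ℤ) (h : (j : ℤ) < |o - i|) (x : H) : P o ((R ^ j) (P i x)) = 0 := by
  induction j generalizing o with
  | zero =>
    have : o ≠ i := by rintro rfl; simp at h
    simpa using hP.orth o i this x
  | succ j ih =>
    rw [pow_succ']
    have hs := ((hP.hasSum ((R ^ j) (P i x))).mapL R).mapL (P o)
    refine hs.unique ?_
    convert hasSum_zero with l
    by_cases hl : (j : ℤ) < |l - i|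
    · rw [ih l hl]; simp
    · rw [← hP.proj l]
      refine hR o l ?_ _
      have := abs_sub_le o l i
      push_cast at h
      omega

/-- The blocks of a Neumann series in a tridiagonal contraction decay exponentially. -/
theorem norm_neumann_block_le {R V : H →L[ℂ] H} {τ : ℂ} (hq : ‖R‖ < 1)
    (hR : ∀ o i : ℤ, 1 < |o - i| → ∀ x, P o (R (P i x)) = 0)
    (hV : HasSum (fun j : ℕ => τ • R ^ j) V) (o i : ℤ) (x : H) :
    ‖P o (V (P i x))‖ ≤ ‖τ‖ * (1 - ‖R‖)⁻¹ * ‖R‖ ^ (i - o).natAbs * ‖x‖ := by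
  set n := (i - o).natAbs with hn
  have h1 : HasSum (fun j : ℕ => P o ((τ • R ^ j) (P i x))) (P o (V (P i x))) := by
    have := (hV.mapL (ContinuousLinearMap.apply ℂ H (P i x))).mapL (P o)
    simpa using this
  -- Powers below n = |i - o| do not reach from slot i to slot o, so only the geometric tail from n
  -- on contributes.
  have h2 : HasSum (fun j : ℕ => P o ((τ • R ^ (j + n)) (P i x))) (P o (V (P i x))) := by
    rw [hasSum_nat_add_iff' (f := fun j : ℕ => P o ((τ • R ^ j) (P i x))) n |>.symm] at h1
    convert h1 using 1
    rw [Finset.sum_eq_zero, sub_zero]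
    intro j hj
    rw [smul_apply, map_smul, hP.pow_banded hR, smul_zero]
    rw [Finset.mem_range] at hj
    rw [abs_sub_comm, Int.abs_eq_natAbs]
    exact_mod_cast hj
  have hg : HasSum (fun j : ℕ => ‖τ‖ * ‖R‖ ^ n * ‖x‖ * ‖R‖ ^ j)
      (‖τ‖ * ‖R‖ ^ n * ‖x‖ * (1 - ‖R‖)⁻¹) :=
    (hasSum_geometric_of_lt_one (norm_nonneg _) hq).mul_left _
  have h3 : ∀ j : ℕ, ‖P o ((τ • R ^ (j + n)) (P i x))‖ ≤ ‖τ‖ * ‖R‖ ^ n * ‖x‖ * ‖R‖ ^ j := by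
    intro j
    refine (hP.norm_apply_le _ _).trans ?_
    rw [smul_apply, norm_smul]
    have hpow : ‖(R ^ (j + n)) (P i x)‖ ≤ ‖R‖ ^ (j + n) * ‖x‖ := by
      induction j + n with
      | zero => simpa using hP.norm_apply_le i x
      | succ m ih =>
        rw [pow_succ' R, pow_succ' ‖R‖, mul_assoc]
        exact (R.le_opNorm _).trans (mul_le_mul_of_nonneg_left ih (norm_nonneg _))
    calc ‖τ‖ * ‖(R ^ (j + n)) (P i x)‖ ≤ ‖τ‖ * (‖R‖ ^ (j + n) * ‖x‖) := by gcongr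
      _ = _ := by ring
  have := tsum_of_norm_bounded hg h3
  rw [h2.tsum_eq] at this
  exact this.trans_eq (by ring)

end IsOrthogonalPartition

end Partition

end

/-! ### Bounded multipliers on L²(ℝ). -/

section

/-- Bounded measurable functions on the line. -/
def BddMeas (φ : ℝ → ℂ) : Prop := Measurable φ ∧ ∃ K, ∀ t, ‖φ t‖ ≤ K

namespace BddMeas

variable {φ ψ : ℝ → ℂ}

theorem memLp (h : BddMeas φ) : MemLp φ ∞ (volume : Measure ℝ) :=
  let ⟨K, hK⟩ := h.2
  memLp_top_of_bound h.1.aestronglyMeasurable K (.of_forall hK)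

theorem const (a : ℂ) : BddMeas fun _ => a := ⟨measurable_const, ‖a‖, fun _ => le_rfl⟩

theorem add (hφ : BddMeas φ) (hψ : BddMeas ψ) : BddMeas fun t => φ t + ψ t := by
  obtain ⟨mφ, K, hK⟩ := hφ
  obtain ⟨mψ, L, hL⟩ := hψ
  exact ⟨mφ.add mψ, K + L, fun t => (norm_add_le _ _).trans (add_le_add (hK t) (hL t))⟩

theorem mul (hφ : BddMeas φ) (hψ : BddMeas ψ) : BddMeas fun t => φ t * ψ t := by
  obtain ⟨mφ, K, hK⟩ := hφ
  obtain ⟨mψ, L, hL⟩ := hψ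
  refine ⟨mφ.mul mψ, K * L, fun t => ?_⟩
  rw [norm_mul]
  exact mul_le_mul (hK t) (hL t) (norm_nonneg _) ((norm_nonneg _).trans (hK t))

theorem star (hφ : BddMeas φ) : BddMeas fun t => (starRingEnd ℂ) (φ t) := by
  obtain ⟨mφ, K, hK⟩ := hφ
  exact ⟨Complex.continuous_conj.measurable.comp mφ, K, fun t => by simpa using hK t⟩

theorem comp (hφ : BddMeas φ) {u : ℝ → ℝ} (hu : Measurable u) : BddMeas fun t => φ (u t) :=
  ⟨hφ.1.comp hu, hφ.2.imp fun _ hK t => hK (u t)⟩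

theorem indicator {s : Set ℝ} (hs : MeasurableSet s) : BddMeas (s.indicator 1) := by
  refine ⟨measurable_one.indicator hs, 1, fun t => ?_⟩
  by_cases h : t ∈ s <;> simp [h]

theorem character (ξ : ℝ) : BddMeas (character ξ) := by
  refine ⟨(by unfold NSGabor.character; fun_prop : Continuous (NSGabor.character ξ)).measurable, 1,
    fun t => ?_⟩
  have h : 2 * Real.pi * Complex.I * (ξ : ℂ) * (t : ℂ)
      = ((2 * Real.pi * ξ * t : ℝ) : ℂ) * Complex.I := by push_cast; ring
  rw [NSGabor.character, h, Complex.norm_exp_ofReal_mul_I]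

theorem sum {ι : Type*} (F : Finset ι) {φ : ι → ℝ → ℂ} (h : ∀ i, BddMeas (φ i)) :
    BddMeas fun t => ∑ i ∈ F, φ i t := by
  classical
  induction F using Finset.induction_on with
  | empty => simpa using const 0
  | insert a F ha ih => simpa [Finset.sum_insert ha] using (h a).add ih

end BddMeas

open Classical in
/-- Multiplication by an essentially bounded function, as an operator on `L²(ℝ)`. -/
def mulOp (φ : ℝ → ℂ) : L2 →L[ℂ] L2 :=
  if h : MemLp φ ∞ (volume : Measure ℝ) then
    (ContinuousLinearMap.mul ℂ ℂ).holderL (volume : Measure ℝ) ∞ 2 2 (h.toLp φ) else 0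

theorem coeFn_mulOp {φ : ℝ → ℂ} (h : BddMeas φ) (f : L2) :
    ⇑(mulOp φ f) =ᵐ[volume] fun t => φ t * f t := by
  rw [mulOp, dif_pos h.memLp, ContinuousLinearMap.holderL_apply_apply]
  filter_upwards [(ContinuousLinearMap.mul ℂ ℂ).coeFn_holder (r := 2) (h.memLp.toLp φ) f,
    h.memLp.coeFn_toLp] with t h1 h2
  rw [h1, ContinuousLinearMap.mul_apply', h2]

theorem eq_mulOp_iff {φ : ℝ → ℂ} (h : BddMeas φ) {f k : L2} :
    k = mulOp φ f ↔ ∀ᵐ t, k t = φ t * f t := by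
  rw [Lp.ext_iff]
  constructor <;> intro hk <;> filter_upwards [hk, coeFn_mulOp h f] with t h1 h2
  · rw [h1, h2]
  · rw [h1, h2]

theorem mulOp_congr {φ ψ : ℝ → ℂ} (hφ : BddMeas φ) (hψ : BddMeas ψ) {f k : L2}
    (h : ∀ᵐ t, φ t * f t = ψ t * k t) : mulOp φ f = mulOp ψ k := by
  rw [eq_mulOp_iff hψ]
  filter_upwards [h, coeFn_mulOp hφ f] with t h1 h2
  rw [h2, h1]

theorem norm_mulOp_le {φ : ℝ → ℂ} (h : BddMeas φ) {K : ℝ} (hK : ∀ t, ‖φ t‖ ≤ K) (f : L2) :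
    ‖mulOp φ f‖ ≤ K * ‖f‖ := by
  refine Lp.norm_le_mul_norm_of_ae_le_mul ?_
  filter_upwards [coeFn_mulOp h f] with t ht
  rw [ht, norm_mul]
  gcongr
  exact hK t

theorem mulOp_mul {φ ψ : ℝ → ℂ} (hφ : BddMeas φ) (hψ : BddMeas ψ) (f : L2) :
    mulOp (fun t => φ t * ψ t) f = mulOp φ (mulOp ψ f) := by
  refine mulOp_congr (hφ.mul hψ) hφ ?_
  filter_upwards [coeFn_mulOp hψ f] with t ht
  rw [ht, mul_assoc]

theorem mulOp_add {φ ψ : ℝ → ℂ} (hφ : BddMeas φ) (hψ : BddMeas ψ) :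
    mulOp (fun t => φ t + ψ t) = mulOp φ + mulOp ψ := by
  ext1 f
  symm
  rw [eq_mulOp_iff (hφ.add hψ), add_apply]
  filter_upwards [coeFn_mulOp hψ f, coeFn_mulOp hφ f, Lp.coeFn_add (mulOp φ f) (mulOp ψ f)]
    with t h1 h2 h3
  rw [h3, Pi.add_apply, h1, h2, add_mul]

theorem mulOp_const (a : ℂ) : mulOp (fun _ => a) = a • 1 := by
  ext1 f
  symm
  rw [eq_mulOp_iff (BddMeas.const a)]
  filter_upwards [Lp.coeFn_smul a f] with t h1
  exact h1

theorem mulOp_zero : mulOp (fun _ => 0) = 0 := by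
  have := mulOp_const 0
  simpa using this

theorem mulOp_comm {φ ψ : ℝ → ℂ} (hφ : BddMeas φ) (hψ : BddMeas ψ) (f : L2) :
    mulOp φ (mulOp ψ f) = mulOp ψ (mulOp φ f) := by
  rw [← mulOp_mul hφ hψ, ← mulOp_mul hψ hφ]
  simp only [mul_comm]

theorem mulOp_sum {ι : Type*} (F : Finset ι) {φ : ι → ℝ → ℂ} (h : ∀ i, BddMeas (φ i)) :
    mulOp (fun t => ∑ i ∈ F, φ i t) = ∑ i ∈ F, mulOp (φ i) := by
  classical
  induction F using Finset.induction_on with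
  | empty => simpa using mulOp_zero
  | insert a F ha ih =>
    simp only [Finset.sum_insert ha]
    rw [mulOp_add (h a) (BddMeas.sum F h), ih]

theorem inner_mulOp_left {φ : ℝ → ℂ} (h : BddMeas φ) (f k : L2) :
    inner ℂ (mulOp φ f) k = inner ℂ f (mulOp (fun t => (starRingEnd ℂ) (φ t)) k) := by
  rw [L2.inner_def, L2.inner_def]
  refine integral_congr_ae ?_
  filter_upwards [coeFn_mulOp h f, coeFn_mulOp h.star k] with t h1 h2
  rw [h1, h2]
  simp [RCLike.inner_apply]
  ring

theorem norm_sq_eq_integral (f : L2) : ‖f‖ ^ 2 = ∫ t, ‖f t‖ ^ 2 := by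
  have h := inner_self_eq_norm_sq_to_K (𝕜 := ℂ) f
  rw [L2.inner_def] at h
  simp only [inner_self_eq_norm_sq_to_K] at h
  have h2 : ((∫ t, ‖f t‖ ^ 2 : ℝ) : ℂ) = ∫ t, ((‖f t‖ : ℂ)) ^ 2 := by
    rw [← integral_complex_ofReal]; push_cast; rfl
  have h3 : ((∫ t, ‖f t‖ ^ 2 : ℝ) : ℂ) = ((‖f‖ ^ 2 : ℝ) : ℂ) := by
    rw [h2]; push_cast; exact h
  exact_mod_cast h3.symm

theorem integrable_norm_sq (f : L2) : Integrable fun t => ‖f t‖ ^ 2 :=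
  (memLp_two_iff_integrable_sq_norm (Lp.aestronglyMeasurable f)).1 (Lp.memLp f)

/-- Bounded pointwise convergence of multipliers implies strong convergence. -/
theorem tendsto_mulOp {ι : Type*} {l : Filter ι} [l.IsCountablyGenerated] {φ : ι → ℝ → ℂ}
    {ψ : ℝ → ℂ} {K : ℝ} (hφ : ∀ i, BddMeas (φ i)) (hψ : BddMeas ψ) (hK : ∀ i t, ‖φ i t‖ ≤ K)
    (hlim : ∀ᵐ t, Filter.Tendsto (fun i => φ i t) l (𝓝 (ψ t))) (f : L2) :
    Filter.Tendsto (fun i => mulOp (φ i) f) l (𝓝 (mulOp ψ f)) := by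
  rw [tendsto_iff_norm_sub_tendsto_zero]
  have h1 : ∀ i, ‖mulOp (φ i) f - mulOp ψ f‖ ^ 2 = ∫ t, ‖(φ i t - ψ t) * f t‖ ^ 2 := by
    intro i
    rw [norm_sq_eq_integral]
    refine integral_congr_ae ?_
    filter_upwards [coeFn_mulOp (hφ i) f, coeFn_mulOp hψ f,
      Lp.coeFn_sub (mulOp (φ i) f) (mulOp ψ f)] with t h1 h2 h3
    rw [h3, Pi.sub_apply, h1, h2, sub_mul]
  obtain ⟨L, hL⟩ := hψ.2
  have h2 : Filter.Tendsto (fun i => ∫ t, ‖(φ i t - ψ t) * f t‖ ^ 2) l (𝓝 (∫ _ : ℝ, (0 : ℝ))) := by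
    refine tendsto_integral_filter_of_dominated_convergence
      (fun t => (K + L) ^ 2 * ‖f t‖ ^ 2) ?_ ?_ ((integrable_norm_sq f).const_mul _) ?_
    · refine .of_forall fun i => ?_
      exact ((((hφ i).1.sub hψ.1).aestronglyMeasurable).mul (Lp.aestronglyMeasurable f)).norm.pow 2
    · refine .of_forall fun i => .of_forall fun t => ?_
      rw [Real.norm_of_nonneg (by positivity), norm_mul, mul_pow]
      gcongr
      exact (norm_sub_le _ _).trans (add_le_add (hK i t) (hL t))
    · filter_upwards [hlim] with t ht
      have := ((ht.sub_const (ψ t)).mul_const (f t)).norm.pow 2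
      simpa using this
  have h3 := (Real.continuous_sqrt.tendsto _).comp h2
  simp only [integral_zero, Real.sqrt_zero] at h3
  refine h3.congr fun i => ?_
  rw [Function.comp, ← h1, Real.sqrt_sq (norm_nonneg _)]

theorem commute_mulOp_of_tendsto {ι : Type*} {l : Filter ι} [l.IsCountablyGenerated] [l.NeBot]
    {φ : ι → ℝ → ℂ}
    {ψ : ℝ → ℂ} {K : ℝ} (hφ : ∀ i, BddMeas (φ i)) (hψ : BddMeas ψ) (hK : ∀ i t, ‖φ i t‖ ≤ K)
    (hlim : ∀ᵐ t, Filter.Tendsto (fun i => φ i t) l (𝓝 (ψ t))) {W : L2 →L[ℂ] L2}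
    (hW : ∀ i f, W (mulOp (φ i) f) = mulOp (φ i) (W f)) (f : L2) :
    W (mulOp ψ f) = mulOp ψ (W f) := by
  have h1 := (W.continuous.tendsto _).comp (tendsto_mulOp hφ hψ hK hlim f)
  have h2 := tendsto_mulOp hφ hψ hK hlim (W f)
  exact tendsto_nhds_unique h1 (h2.congr fun i => (hW i f).symm)

end

/-! ### Commuting with multipliers: symbols and periodic functions. -/

section

theorem gaussian_memLp : MemLp (fun t : ℝ => ((Real.exp (-t ^ 2) : ℝ) : ℂ)) 2 volume := by
  have hc : Continuous fun t : ℝ => ((Real.exp (-t ^ 2) : ℝ) : ℂ) := by fun_prop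
  rw [memLp_two_iff_integrable_sq_norm hc.aestronglyMeasurable]
  refine (integrable_exp_neg_mul_sq (b := 2) (by norm_num)).congr (.of_forall fun t => ?_)
  simp only [Complex.norm_real, Real.norm_eq_abs, Real.abs_exp, ← Real.exp_nat_mul]
  congr 1; push_cast; ring

/-- An operator commuting with all bounded multipliers is itself a multiplier. -/
theorem exists_symbol (V : L2 →L[ℂ] L2)
    (hV : ∀ φ, BddMeas φ → ∀ f, V (mulOp φ f) = mulOp φ (V f)) :
    ∃ ω, Measurable ω ∧ (∀ t, ‖ω t‖ ≤ ‖V‖) ∧ V = mulOp ω := by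
  -- The constant 1 is not in L², so a nowhere vanishing Gaussian replaces it; the symbol is V h₀ /
  -- h₀.
  set h₀ : ℝ → ℂ := fun t => ((Real.exp (-t ^ 2) : ℝ) : ℂ) with hh₀
  have hc : Continuous h₀ := by fun_prop
  have hpos : ∀ t, h₀ t ≠ 0 := fun t => by
    simpa only [hh₀, ne_eq, Complex.ofReal_eq_zero] using (Real.exp_pos _).ne'
  have hle : ∀ t, ‖h₀ t‖ ≤ 1 := fun t => by
    simp only [hh₀, Complex.norm_real, Real.norm_eq_abs, Real.abs_exp]
    exact Real.exp_le_one_iff.2 (by nlinarith [sq_nonneg t])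
  set H₀ : L2 := gaussian_memLp.toLp with hH₀
  have hH : ⇑H₀ =ᵐ[volume] h₀ := gaussian_memLp.coeFn_toLp
  set G : L2 := V H₀ with hG
  have hGm : Measurable G := (Lp.stronglyMeasurable G).measurable
  -- E is null: commuting with its indicator gives ‖1_E V h₀‖ ≤ ‖V‖ ‖1_E h₀‖, whereas the opposite
  -- strict inequality holds at each point of E. Off E the quotient is bounded by ‖V‖.
  set E : Set ℝ := {t | ‖V‖ * ‖h₀ t‖ < ‖G t‖} with hE
  have hEm : MeasurableSet E := measurableSet_lt (by fun_prop) hGm.norm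
  have hEn : ∀ᵐ t, t ∉ E := by
    have b := BddMeas.indicator hEm
    have h1 : ‖mulOp (E.indicator 1) G‖ ≤ ‖V‖ * ‖mulOp (E.indicator 1) H₀‖ := by
      rw [hG, ← hV _ b]; exact V.le_opNorm _
    have h2 := pow_le_pow_left₀ (norm_nonneg _) h1 2
    rw [mul_pow, norm_sq_eq_integral, norm_sq_eq_integral, ← integral_const_mul,
      ← sub_nonneg, ← integral_sub ((integrable_norm_sq _).const_mul _) (integrable_norm_sq _)] at h2
    set D : ℝ → ℝ := fun t => ‖V‖ ^ 2 * ‖mulOp (E.indicator 1) H₀ t‖ ^ 2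
      - ‖mulOp (E.indicator 1) G t‖ ^ 2 with hD
    have hDi : Integrable D := ((integrable_norm_sq _).const_mul _).sub (integrable_norm_sq _)
    have hDE : ∀ᵐ t, D t = E.indicator (fun t => (‖V‖ * ‖h₀ t‖) ^ 2 - ‖G t‖ ^ 2) t := by
      filter_upwards [coeFn_mulOp b H₀, coeFn_mulOp b G, hH] with t e1 e2 e3
      simp only [hD, e1, e2, e3]
      by_cases ht : t ∈ E <;> simp [ht, mul_pow]
    have hneg : ∀ᵐ t, D t ≤ 0 := by
      filter_upwards [hDE] with t e
      rw [e]
      refine Set.indicator_apply_le' (fun ht => ?_) fun _ => le_rfl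
      have : (‖V‖ * ‖h₀ t‖) ^ 2 < ‖G t‖ ^ 2 := pow_lt_pow_left₀ ht (by positivity) two_ne_zero
      linarith
    have hz : ∫ t, (-D) t = 0 := by
      rw [integral_neg']
      have := integral_nonpos_of_ae hneg
      linarith
    rw [integral_eq_zero_iff_of_nonneg_ae (hneg.mono fun t ht => by simpa using ht) hDi.neg] at hz
    filter_upwards [hz, hDE] with t z e ht
    rw [Pi.neg_apply, e, Set.indicator_of_mem ht] at z
    have : (‖V‖ * ‖h₀ t‖) ^ 2 < ‖G t‖ ^ 2 := pow_lt_pow_left₀ ht (by positivity) two_ne_zero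
    simp only [Pi.zero_apply] at z
    linarith
  refine ⟨Eᶜ.indicator fun t => G t / h₀ t, (hGm.div hc.measurable).indicator hEm.compl, ?_, ?_⟩
  · intro t
    by_cases ht : t ∈ E
    · simp [ht]
    · rw [Set.indicator_of_mem (by simpa using ht), norm_div,
        div_le_iff₀ (norm_pos_iff.2 (hpos t))]
      exact not_lt.1 ht
  have hω : BddMeas (Eᶜ.indicator fun t => G t / h₀ t) := by
    refine ⟨(hGm.div hc.measurable).indicator hEm.compl, ‖V‖, fun t => ?_⟩
    by_cases ht : t ∈ E
    · simp [ht]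
    · rw [Set.indicator_of_mem (by simpa using ht), norm_div,
        div_le_iff₀ (norm_pos_iff.2 (hpos t))]
      exact not_lt.1 ht
  ext1 f
  rw [eq_mulOp_iff hω]
  have hfm : Measurable f := (Lp.stronglyMeasurable f).measurable
  have hden : ∀ t, ((1 + ‖f t‖ : ℝ) : ℂ) ≠ 0 := fun t => by
    exact_mod_cast (by positivity : (1 + ‖f t‖ : ℝ) ≠ 0)
  have hmd : Measurable fun t => ((1 + ‖f t‖ : ℝ) : ℂ) :=
    Complex.measurable_ofReal.comp (measurable_const.add hfm.norm)
  have hn : ∀ t, ‖((1 + ‖f t‖ : ℝ) : ℂ)‖ = 1 + ‖f t‖ := fun t => by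
    rw [Complex.norm_real, Real.norm_of_nonneg (by positivity)]
  have b1 : BddMeas fun t => h₀ t / ((1 + ‖f t‖ : ℝ) : ℂ) := by
    refine ⟨hc.measurable.div hmd, 1, fun t => ?_⟩
    rw [norm_div, hn, div_le_one (by positivity)]
    linarith [hle t, norm_nonneg (f t)]
  have b2 : BddMeas fun t => f t / ((1 + ‖f t‖ : ℝ) : ℂ) := by
    refine ⟨hfm.div hmd, 1, fun t => ?_⟩
    rw [norm_div, hn, div_le_one (by positivity)]
    linarith
  -- An arbitrary f need not be a bounded multiple of h₀. After division by 1 + |f| both f and h₀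
  -- become bounded multipliers, and applying V to this identity determines V f.
  have key : mulOp (fun t => h₀ t / ((1 + ‖f t‖ : ℝ) : ℂ)) f
      = mulOp (fun t => f t / ((1 + ‖f t‖ : ℝ) : ℂ)) H₀ := by
    refine mulOp_congr b1 b2 ?_
    filter_upwards [hH] with t ht
    rw [ht]; ring
  have key2 := congrArg V key
  rw [hV _ b1, hV _ b2] at key2
  have key3 := (coeFn_mulOp b1 (V f)).symm.trans ((Lp.ext_iff.1 key2).trans (coeFn_mulOp b2 (V H₀)))
  filter_upwards [key3, hEn] with t h1 h2
  rw [Set.indicator_of_mem (by simpa using h2)]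
  have := hden t
  have := hpos t
  field_simp at h1 ⊢
  exact h1

/-- An operator commuting with the characters of period `T` commutes with continuous
`T`-periodic multipliers. -/
theorem commute_mulOp_of_continuous_periodic {T : ℝ} [hT : Fact (0 < T)] {W : L2 →L[ℂ] L2}
    (hW : ∀ (l : ℤ) f, W (mulOp (character (l / T)) f) = mulOp (character (l / T)) (W f))
    (F : C(AddCircle T, ℂ)) (f : L2) :
    W (mulOp (fun t : ℝ => F t) f) = mulOp (fun t : ℝ => F t) (W f) := by
  have bF : ∀ F : C(AddCircle T, ℂ), BddMeas fun t : ℝ => F t := fun F =>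
    ⟨(F.continuous.comp (AddCircle.continuous_mk' T)).measurable, ‖F‖, fun t => F.norm_coe_le_norm _⟩
  have hadd : ∀ (F G : C(AddCircle T, ℂ)) f, mulOp (fun t : ℝ => (F + G) t) f
      = mulOp (fun t : ℝ => F t) f + mulOp (fun t : ℝ => G t) f := fun F G f => by
    rw [← add_apply, ← mulOp_add (bF F) (bF G)]; rfl
  have hsmul : ∀ (a : ℂ) (F : C(AddCircle T, ℂ)) f, mulOp (fun t : ℝ => (a • F) t) f
      = a • mulOp (fun t : ℝ => F t) f := fun a F f => by
    have := mulOp_mul (BddMeas.const a) (bF F) f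
    rw [mulOp_const] at this
    exact this
  let L (f : L2) : C(AddCircle T, ℂ) →L[ℂ] L2 := LinearMap.mkContinuous
    { toFun := fun F => mulOp (fun t : ℝ => F t) f
      map_add' := fun F G => hadd F G f
      map_smul' := fun a F => hsmul a F f } ‖f‖ fun F => by
        rw [mul_comm]
        exact norm_mulOp_le (bF F) (fun t => F.norm_coe_le_norm _) f
  -- Both sides are continuous and linear in F, and the Fourier monomials span a dense subspace of
  -- the continuous functions on the circle.
  have h : W ∘L L f = L (W f) := by
    refine ContinuousLinearMap.ext_on (s := Set.range (@fourier T)) ?_ ?_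
    · rw [dense_iff_closure_eq, ← Submodule.topologicalClosure_coe, span_fourier_closure_eq_top]
      rfl
    · rintro _ ⟨l, rfl⟩
      have : (fun t : ℝ => fourier l (t : AddCircle T)) = character (l / T) := by
        funext t
        rw [fourier_coe_apply, character]
        congr 1; push_cast; ring
      change W (mulOp (fun t : ℝ => fourier l (t : AddCircle T)) f) =
        mulOp (fun t : ℝ => fourier l (t : AddCircle T)) (W f)
      rw [this]
      exact hW l f
  exact congrArg (fun A : C(AddCircle T, ℂ) →L[ℂ] L2 => A F) h

/-- An operator commuting with the characters of period `T` commutes with bounded measurable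
`T`-periodic multipliers. -/
theorem commute_mulOp_of_periodic {T : ℝ} (hT : 0 < T) {W : L2 →L[ℂ] L2}
    (hW : ∀ (l : ℤ) f, W (mulOp (character (l / T)) f) = mulOp (character (l / T)) (W f))
    {ψ : ℝ → ℂ} (hψ : BddMeas ψ) (hper : Function.Periodic ψ T) (f : L2) :
    W (mulOp ψ f) = mulOp ψ (W f) := by
  have : Fact (0 < T) := ⟨hT⟩
  obtain ⟨K, hK⟩ := hψ.2
  have hloc : LocallyIntegrable ψ volume := fun x =>
    ⟨Metric.ball x 1, Metric.ball_mem_nhds x one_pos,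
      Measure.integrableOn_of_bounded (M := K) (by simp [Real.volume_ball]) hψ.1.aestronglyMeasurable
        (.of_forall hK)⟩
  have hint : ∀ a b, IntervalIntegrable ψ volume a b := fun a b =>
    (hloc.integrableOn_isCompact isCompact_uIcc).intervalIntegrable
  let r : ℕ → ℝ := fun j => 1 / ((j : ℝ) + 1)
  have hr : ∀ j, 0 < r j := fun j => by positivity
  let Ψ : ℝ → ℂ := fun x => ∫ t in (0 : ℝ)..x, ψ t
  have hΨ : Continuous Ψ := intervalIntegral.continuous_primitive hint 0
  -- Sliding averages of ψ over windows of length r j: continuous, T-periodic, bounded by K, and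
  -- convergent to ψ almost everywhere by Lebesgue differentiation.
  let φ : ℕ → ℝ → ℂ := fun j t => (r j : ℂ)⁻¹ * (Ψ (t + r j) - Ψ t)
  have hsub : ∀ j t, Ψ (t + r j) - Ψ t = ∫ s in t..t + r j, ψ s := fun j t =>
    intervalIntegral.integral_interval_sub_left (hint _ _) (hint _ _)
  have hφc : ∀ j, Continuous (φ j) := fun j => by fun_prop
  have hφK : ∀ j t, ‖φ j t‖ ≤ K := fun j t => by
    have := intervalIntegral.norm_integral_le_of_norm_le_const (a := t) (b := t + r j)
      (fun s _ => hK s)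
    rw [add_sub_cancel_left, abs_of_pos (hr j)] at this
    simp only [φ]
    rw [hsub, norm_mul, norm_inv, Complex.norm_real, Real.norm_of_nonneg (hr j).le,
      inv_mul_le_iff₀ (hr j), mul_comm]
    exact this
  have hφp : ∀ j, Function.Periodic (φ j) T := fun j t => by
    simp only [φ, hsub]
    congr 1
    rw [show t + T + r j = t + r j + T by ring, ← intervalIntegral.integral_comp_add_right]
    simp only [hper _]
  have hφb : ∀ j, BddMeas (φ j) := fun j => ⟨(hφc j).measurable, K, hφK j⟩
  refine commute_mulOp_of_tendsto (l := Filter.atTop) (K := K) hφb hψ hφK ?_ (fun j f => ?_) f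
  · filter_upwards [LocallyIntegrable.ae_hasDerivAt_integral hloc] with t ht
    have h1 := hasDerivAt_iff_tendsto_slope_zero.1 (ht 0)
    have h2 : Filter.Tendsto r Filter.atTop (𝓝[≠] 0) :=
      tendsto_nhdsWithin_of_tendsto_nhds_of_eventually_within _
        tendsto_one_div_add_atTop_nhds_zero_nat (.of_forall fun j => (hr j).ne')
    refine (h1.comp h2).congr fun j => ?_
    simp [φ, Ψ, Function.comp]
  · let F : C(AddCircle T, ℂ) := ⟨(hφp j).lift, (hφc j).quotient_lift _⟩
    exact commute_mulOp_of_continuous_periodic hW F f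

end

section

/-! ### Essential supports and modulations -/

theorem ae_eq_zero_of_notMem_essSupport (f : ℝ → ℂ) : ∀ᵐ t, t ∉ essSupport f → f t = 0 := by
  rw [ae_iff]
  refine measure_null_of_locally_null _ fun x hx => ?_
  simp only [Set.mem_ofPred_eq, Classical.not_imp] at hx
  have h := hx.1
  simp only [essSupport, Set.mem_ofPred_eq, not_forall, not_not] at h
  obtain ⟨U, hU, hxU, h0⟩ := h
  rw [ae_restrict_iff' hU.measurableSet, ae_iff] at h0
  refine ⟨_, inter_mem_nhdsWithin _ (hU.mem_nhds hxU), measure_mono_null ?_ h0⟩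
  rintro t ⟨ht, htU⟩
  simp only [Set.mem_ofPred_eq, Classical.not_imp] at ht ⊢
  exact ⟨htU, ht.2⟩

theorem essSupport_subset_of_ae {f : ℝ → ℂ} {E : Set ℝ} (hE : IsClosed E)
    (h : ∀ᵐ t, t ∉ E → f t = 0) : essSupport f ⊆ E := by
  intro x hx
  by_contra hxE
  refine hx Eᶜ hE.isOpen_compl hxE ?_
  rw [ae_restrict_iff' hE.measurableSet.compl]
  exact h

theorem modulation_eq_mulOp (ξ : ℝ) (f : L2) : modulation ξ f = mulOp (character ξ) f := by
  rw [eq_mulOp_iff (.character ξ)]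
  filter_upwards [Lp.coeFn_lpSMul (r := 2) ((memLp_character ξ).toLp (character ξ)) f,
    (memLp_character ξ).coeFn_toLp] with t h1 h2
  rw [modulation, h1, Pi.smul_apply', h2, smul_eq_mul]

theorem restriction_eq_mulOp (I : Set ℝ) (hI : MeasurableSet I) (f : L2) :
    restriction I hI f = mulOp (I.indicator 1) f := by
  rw [eq_mulOp_iff (.indicator hI)]
  filter_upwards [((Lp.memLp f).indicator hI).coeFn_toLp] with t h1
  rw [restriction, h1]
  by_cases h : t ∈ I <;> simp [h]

theorem character_add (ξ η t : ℝ) : character (ξ + η) t = character ξ t * character η t := by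
  simp only [character, ← Complex.exp_add]
  congr 1; push_cast; ring

theorem conj_character (ξ t : ℝ) : (starRingEnd ℂ) (character ξ t) = character (-ξ) t := by
  simp only [character, ← Complex.exp_conj]
  have : (starRingEnd ℂ) 2 = 2 := map_ofNat _ 2
  congr 1
  simp [this]

theorem mulOp_character_mulOp_character (ξ η : ℝ) (f : L2) :
    mulOp (character ξ) (mulOp (character η) f) = mulOp (character (ξ + η)) f := by
  rw [← mulOp_mul (.character ξ) (.character η)]
  congr 2
  funext t
  exact (character_add _ _ _).symm

theorem gaborSystem_eq (g : ℤ → L2) (b : ℤ → ℝ) (m n : ℤ) :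
    gaborSystem g b (m, n) = mulOp (character (m * b n)) (g n) := modulation_eq_mulOp _ _

/-! ### The geometry of the supports -/

/-- The consequences of the assumptions on the supports and the modulation parameters
that drive the proof. -/
structure Geometry (b c d : ℤ → ℝ) (ε : ℝ) : Prop where
  eps_pos : 0 < ε
  lt_length : ∀ n, (b n)⁻¹ < d n - c n
  length_le : ∀ n, d n - c n + 2 * ε ≤ 2 * (b n)⁻¹
  left_le : ∀ n, c (n + 1) + ε ≤ c n + (b n)⁻¹
  right_le : ∀ n, d (n + 1) + ε ≤ d n + (b (n + 1))⁻¹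
  right_le_left : ∀ n, d n ≤ c (n + 2)

theorem Geometry.of_bounds {b c d : ℤ → ℝ} {ε : ℝ} (hcd : ∀ n, c n < d n)
    (hb : ∀ n, 1 / (d n - c n) < b n) (hε : 0 < ε) (hoverlap : ∀ n, d (n - 1) ≤ c (n + 1))
    (hbinv : ∀ n, max (max ((d n - c n) / 2) (c (n + 1) - c n)) (d n - d (n - 1)) + ε ≤ (b n)⁻¹) :
    Geometry b c d ε where
  eps_pos := hε
  lt_length n := by
    have h0 : 0 < d n - c n := sub_pos.2 (hcd n)
    rw [inv_lt_comm₀ ((one_div_pos.2 h0).trans (hb n)) h0, ← one_div]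
    exact hb n
  length_le n := by
    have h1 := hbinv n
    have h2 := (le_max_left _ _).trans (le_max_left (max ((d n - c n) / 2) (c (n + 1) - c n))
      (d n - d (n - 1)))
    linarith
  left_le n := by
    have h1 := hbinv n
    have h2 := (le_max_right _ _).trans (le_max_left (max ((d n - c n) / 2) (c (n + 1) - c n))
      (d n - d (n - 1)))
    linarith
  right_le n := by
    have h1 := hbinv (n + 1)
    rw [add_sub_cancel_right] at h1
    have h2 := le_max_right (max ((d (n + 1) - c (n + 1)) / 2) (c (n + 1 + 1) - c (n + 1)))
      (d (n + 1) - d n)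
    linarith
  right_le_left n := by
    have := hoverlap (n + 1)
    rwa [add_sub_cancel_right, add_assoc] at this

/-- The total shift `∑_{0 ≤ j < m} 1 / b_j`, with the usual convention for negative `m`. -/
def totalShift (b : ℤ → ℝ) (m : ℤ) : ℝ := Bplus b 0 m.toNat - Bminus b (-1) (-m).toNat

theorem totalShift_succ (b : ℤ → ℝ) (m : ℤ) :
    totalShift b (m + 1) = totalShift b m + (b m)⁻¹ := by
  rcases m with k | k
  · have h1 : (Int.ofNat k + 1).toNat = k + 1 := by simp
    have h2 : (-(Int.ofNat k + 1)).toNat = 0 := by simp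
    have h3 : (-(Int.ofNat k)).toNat = 0 := by simp
    have h4 : (Int.ofNat k).toNat = k := by simp
    rw [totalShift, totalShift, h1, h2, h3, h4, Bplus, Finset.sum_range_succ, ← Bplus]
    simp only [zero_add, Int.ofNat_eq_natCast]
    ring
  · have h1 : (Int.negSucc k + 1).toNat = 0 := by omega
    have h2 : (-(Int.negSucc k + 1)).toNat = k := by omega
    have h3 : (-(Int.negSucc k)).toNat = k + 1 := by omega
    have h4 : (Int.negSucc k).toNat = 0 := by omega
    have h5 : (-1 - k : ℤ) = Int.negSucc k := by omega
    rw [totalShift, totalShift, h1, h2, h3, h4, Bminus, Bminus, Finset.sum_range_succ, h5]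
    ring

theorem Bplus_eq (b : ℤ → ℝ) (n : ℤ) (k : ℕ) :
    Bplus b n k = totalShift b (n + k) - totalShift b n := by
  induction k with
  | zero => simp [Bplus]
  | succ k ih =>
    rw [Bplus, Finset.sum_range_succ, ← Bplus, ih]
    push_cast
    rw [← add_assoc, totalShift_succ]
    ring

theorem Bminus_eq (b : ℤ → ℝ) (n : ℤ) (k : ℕ) :
    Bminus b n k = totalShift b (n + 1) - totalShift b (n + 1 - k) := by
  induction k with
  | zero => simp [Bminus]
  | succ k ih =>
    rw [Bminus, Finset.sum_range_succ, ← Bminus, ih]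
    have h := totalShift_succ b (n - k)
    rw [show n - (k : ℤ) + 1 = n + 1 - k by ring] at h
    rw [h, show n + 1 - ((k + 1 : ℕ) : ℤ) = n - k by push_cast; ring]
    ring

open Classical in
/-- The index `m` with `c m ≤ t < c (m + 1)`. -/
def slotIndex (c : ℤ → ℝ) (t : ℝ) : ℤ :=
  if h : ∃ m, c m ≤ t ∧ t < c (m + 1) then h.choose else 0

/-- The position of `t` on the line obtained by undoing the shifts. -/
def unshifted (b c : ℤ → ℝ) (t : ℝ) : ℝ := t - totalShift b (slotIndex c t)

/-- Functions that are constant along the chains `t, t + 1 / b_n, …`. -/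
def ChainInvariant (b c d : ℤ → ℝ) (φ : ℝ → ℂ) : Prop :=
  ∀ n t, c n < t → t + (b n)⁻¹ < d n → φ (t + (b n)⁻¹) = φ t

/-- The projection onto the functions living on `[c m, c (m + 1))`. -/
def slotProj (c : ℤ → ℝ) (m : ℤ) : L2 →L[ℂ] L2 :=
  mulOp ((Set.Ico (c m) (c (m + 1))).indicator 1)

namespace Geometry

variable {b c d : ℤ → ℝ} {ε : ℝ} (G : Geometry b c d ε)
include G

theorem left_succ_lt (n : ℤ) : c (n + 1) + ε < d n := by
  linarith [G.left_le n, G.lt_length n]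

/-- The supports with indices n-1 and n overlap by more than ε, and the former ends no later than c
(n+1). These uniform gaps make the slots exhaust the line. -/
theorem step (n : ℤ) : c n + ε < c (n + 1) := by
  have h1 := G.left_succ_lt (n - 1)
  have h2 := G.right_le_left (n - 1)
  rw [show n - 1 + 1 = n by ring] at h1
  rw [show n - 1 + 2 = n + 1 by ring] at h2
  linarith

theorem strictMono : StrictMono c :=
  strictMono_int_of_lt_succ fun n => by linarith [G.step n, G.eps_pos]

theorem shift_pos (n : ℤ) : 0 < (b n)⁻¹ := by
  linarith [G.left_le n, G.step n, G.eps_pos]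

theorem left_add_le (n : ℤ) (k : ℕ) : c n + k * ε ≤ c (n + k) := by
  induction k with
  | zero => simp
  | succ k ih =>
    have := G.step (n + k)
    push_cast
    rw [← add_assoc]
    linarith

theorem exists_slot (t : ℝ) : ∃ m, c m ≤ t ∧ t < c (m + 1) := by
  obtain ⟨K, hK⟩ := exists_nat_gt (|t - c 0| / ε)
  rw [div_lt_iff₀ G.eps_pos, abs_lt] at hK
  have h1 := G.left_add_le 0 K
  have h2 := G.left_add_le (-K) K
  rw [zero_add] at h1
  rw [neg_add_cancel] at h2
  obtain ⟨m, hm, hmax⟩ := Int.exists_greatest_of_bdd (P := fun m => c m ≤ t)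
    ⟨K, fun z hz => le_of_lt (G.strictMono.lt_iff_lt.1 (by linarith))⟩ ⟨-K, by linarith⟩
  refine ⟨m, hm, not_le.1 fun h => ?_⟩
  have := hmax _ h
  omega

theorem slotIndex_eq_iff {t : ℝ} {m : ℤ} : slotIndex c t = m ↔ t ∈ Set.Ico (c m) (c (m + 1)) := by
  have h := G.exists_slot t
  have hs : c (slotIndex c t) ≤ t ∧ t < c (slotIndex c t + 1) := by
    rw [slotIndex, dif_pos h]; exact h.choose_spec
  constructor
  · rintro rfl; exact hs
  · rintro ⟨h1, h2⟩
    have h3 := G.strictMono.lt_iff_lt.1 (hs.1.trans_lt h2)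
    have h4 := G.strictMono.lt_iff_lt.1 (h1.trans_lt hs.2)
    omega

theorem measurable_slotIndex : Measurable (slotIndex c) := by
  refine measurable_to_countable' fun m => ?_
  have : slotIndex c ⁻¹' {m} = Set.Ico (c m) (c (m + 1)) := by
    ext t; exact G.slotIndex_eq_iff
  rw [this]; exact measurableSet_Ico

theorem measurable_unshifted : Measurable (unshifted b c) :=
  measurable_id.sub ((Measurable.of_discrete (f := totalShift b)).comp G.measurable_slotIndex)

/-- Here t < d_n - 1/b_n < d_{n-1} ≤ c_{n+1} and c_{n+1} < c_n + 1/b_n < t + 1/b_n < d_n ≤ c_{n+2}.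
Since a chain step moves up exactly one slot, `totalShift` compensates it and `unshifted` is
constant along chains. -/
theorem slotIndex_of_link {n : ℤ} {t : ℝ} (h1 : c n < t) (h2 : t + (b n)⁻¹ < d n) :
    slotIndex c t = n ∧ slotIndex c (t + (b n)⁻¹) = n + 1 := by
  have e1 := G.right_le (n - 1)
  have e2 := G.right_le_left (n - 1)
  have e3 := G.left_le n
  have e4 := G.right_le_left n
  have e5 := G.eps_pos
  rw [show n - 1 + 1 = n by ring] at e1
  rw [show n - 1 + 2 = n + 1 by ring] at e2
  rw [G.slotIndex_eq_iff, G.slotIndex_eq_iff, add_assoc]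
  exact ⟨⟨h1.le, by linarith⟩, by linarith, by rw [show n + (1 + 1) = n + 2 by ring]; linarith⟩

theorem unshifted_of_link {n : ℤ} {t : ℝ} (h1 : c n < t) (h2 : t + (b n)⁻¹ < d n) :
    unshifted b c (t + (b n)⁻¹) = unshifted b c t := by
  obtain ⟨e1, e2⟩ := G.slotIndex_of_link h1 h2
  rw [unshifted, unshifted, e1, e2, totalShift_succ]
  ring

theorem chainInvariant_comp_unshifted (η : ℝ → ℂ) :
    ChainInvariant b c d fun t => η (unshifted b c t) := fun _ _ h1 h2 => by
  simp only [G.unshifted_of_link h1 h2]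

/-- Cutting off the part of the chains to the left of the link `m`, at positions where the slots
`m` and `m + 1` are not linked. -/
theorem chainInvariant_cut_left (m : ℤ) {s : Set ℝ}
    (hs : ∀ u ∈ s, u ≤ c m - totalShift b m ∨ d m - totalShift b (m + 1) ≤ u) :
    ChainInvariant b c d ({t | slotIndex c t ≤ m ∧ unshifted b c t ∈ s}.indicator 1) := by
  intro n t h1 h2
  obtain ⟨e1, e2⟩ := G.slotIndex_of_link h1 h2
  have e3 := G.unshifted_of_link h1 h2
  classical
  simp only [Set.indicator_apply, Set.mem_ofPred_eq, e1, e2, e3]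
  have : (n + 1 ≤ m ∧ unshifted b c t ∈ s) ↔ (n ≤ m ∧ unshifted b c t ∈ s) := by
    -- The two conditions can differ only at n = m, but a link there forces u strictly between c m -
    -- σ(m) and d m - σ(m+1), which `hs` excludes.
    refine ⟨fun h => ⟨by omega, h.2⟩, fun h => ⟨?_, h.2⟩⟩
    by_contra hn
    obtain rfl : n = m := by omega
    have := hs _ h.2
    rw [unshifted, e1, totalShift_succ] at this
    rcases this with h | h <;> linarith
  exact if_congr this rfl rfl

/-- Cutting off the part of the chains to the right of the link `m`, at positions where the slots
`m` and `m + 1` are not linked. -/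
theorem chainInvariant_cut_right (m : ℤ) {s : Set ℝ}
    (hs : ∀ u ∈ s, u ≤ c m - totalShift b m ∨ d m - totalShift b (m + 1) ≤ u) :
    ChainInvariant b c d ({t | m < slotIndex c t ∧ unshifted b c t ∈ s}.indicator 1) := by
  intro n t h1 h2
  obtain ⟨e1, e2⟩ := G.slotIndex_of_link h1 h2
  have e3 := G.unshifted_of_link h1 h2
  classical
  simp only [Set.indicator_apply, Set.mem_ofPred_eq, e1, e2, e3]
  have : (m < n + 1 ∧ unshifted b c t ∈ s) ↔ (m < n ∧ unshifted b c t ∈ s) := by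
    refine ⟨fun h => ⟨?_, h.2⟩, fun h => ⟨by omega, h.2⟩⟩
    by_contra hn
    obtain rfl : n = m := by omega
    have := hs _ h.2
    rw [unshifted, e1, totalShift_succ] at this
    rcases this with h | h <;> linarith
  exact if_congr this rfl rfl

/-- In the coordinate `unshifted`, link n occupies the range from c n - σ(n) to d n - σ(n+1). This
bound and the next show both ends falling by at least ε per index. Hence a run of links shares the
range with the left end of its first link and the right end of its last, and each further link costs
ε. -/
theorem left_sub_totalShift_le (n : ℤ) (k : ℕ) :
    c (n + k) - totalShift b (n + k) + k * ε ≤ c n - totalShift b n := by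
  induction k with
  | zero => simp
  | succ k ih =>
    have h1 := G.left_le (n + k)
    have h2 := totalShift_succ b (n + k)
    push_cast
    rw [← add_assoc]
    linarith

theorem right_sub_totalShift_le (n : ℤ) (k : ℕ) :
    d (n + k) - totalShift b (n + k + 1) + k * ε ≤ d n - totalShift b (n + 1) := by
  induction k with
  | zero => simp
  | succ k ih =>
    have h1 := G.right_le (n + k)
    have h2 := totalShift_succ b (n + k + 1)
    push_cast
    rw [← add_assoc]
    linarith

theorem slotProj_isOrthogonalPartition : IsOrthogonalPartition (slotProj c) where
  proj o x := by
    have h := BddMeas.indicator (measurableSet_Ico (a := c o) (b := c (o + 1)))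
    rw [slotProj, ← mulOp_mul h h]
    congr 2
    funext t
    by_cases ht : t ∈ Set.Ico (c o) (c (o + 1)) <;> simp [ht]
  orth o i hoi x := by
    have h := BddMeas.indicator (measurableSet_Ico (a := c o) (b := c (o + 1)))
    have h' := BddMeas.indicator (measurableSet_Ico (a := c i) (b := c (i + 1)))
    rw [slotProj, slotProj, ← mulOp_mul h h']
    have : (fun t => (Set.Ico (c o) (c (o + 1))).indicator (1 : ℝ → ℂ) t *
        (Set.Ico (c i) (c (i + 1))).indicator 1 t) = fun _ => 0 := by
      funext t
      by_cases h1 : t ∈ Set.Ico (c o) (c (o + 1))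
      · have h2 : t ∉ Set.Ico (c i) (c (i + 1)) := fun h2 =>
          hoi ((G.slotIndex_eq_iff.2 h1).symm.trans (G.slotIndex_eq_iff.2 h2))
        rw [Set.indicator_of_notMem h2, mul_zero]
      · rw [Set.indicator_of_notMem h1, zero_mul]
    rw [this, mulOp_zero]; rfl
  symm o x y := by
    have h := BddMeas.indicator (measurableSet_Ico (a := c o) (b := c (o + 1)))
    rw [slotProj, inner_mulOp_left h]
    congr 3
    funext t
    by_cases ht : t ∈ Set.Ico (c o) (c (o + 1)) <;> simp [ht]
  hasSum x := by
    have hb := fun o => BddMeas.indicator (measurableSet_Ico (a := c o) (b := c (o + 1)))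
    have hone : ∀ (F : Finset ℤ) t, ∑ o ∈ F, (Set.Ico (c o) (c (o + 1))).indicator (1 : ℝ → ℂ) t
        = if slotIndex c t ∈ F then 1 else 0 := by
      intro F t
      rw [← Finset.sum_ite_eq' F (slotIndex c t) fun _ => (1 : ℂ)]
      refine Finset.sum_congr rfl fun o _ => ?_
      simp only [Set.indicator_apply, ← G.slotIndex_eq_iff, Pi.one_apply, eq_comm]
    have h1 := tendsto_mulOp (l := (Filter.atTop : Filter (Finset ℤ))) (K := 1)
      (φ := fun F t => ∑ o ∈ F, (Set.Ico (c o) (c (o + 1))).indicator 1 t) (ψ := fun _ => 1)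
      (fun F => BddMeas.sum F hb) (BddMeas.const 1) (fun F t => by
        rw [hone]; split_ifs <;> simp) (.of_forall fun t => by
        refine tendsto_const_nhds.congr' ?_
        filter_upwards [Filter.eventually_ge_atTop {slotIndex c t}] with F hF
        rw [hone, if_pos (hF (Finset.mem_singleton_self _))]) x
    rw [mulOp_const, one_smul] at h1
    refine h1.congr fun F => ?_
    rw [mulOp_sum F hb, sum_apply]
    rfl

end Geometry

end

section

/-- Supports are closed while slots are half-open, and d n = c (n+2) is possible. Discarding these
points keeps the support of g n inside the slots n and n+1. -/
theorem ae_ne_all (d : ℤ → ℝ) : ∀ᵐ t : ℝ, ∀ n, t ≠ d n :=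
  ae_all_iff.2 fun n => by simp [ae_iff]

/-! ### The frame operator -/

/-- The frame operator of a family of modulations commutes with the characters of the
dual period. -/
theorem IsFrameOperator.commute_character {g : L2} {β : ℝ} {S : L2 →L[ℂ] L2}
    (hS : IsFrameOperator (fun m : ℤ => mulOp (character (m * β)) g) S) (l : ℤ) (f : L2) :
    S (mulOp (character (l * β)) f) = mulOp (character (l * β)) (S f) := by
  have h1 := (hS f).mapL (mulOp (character (l * β)))
  -- The character of frequency lβ permutes the family, so reindexing by m ↦ m + l matches the two
  -- series term by term.
  have h2 := (Equiv.addRight l).hasSum_iff.2 (hS (mulOp (character (l * β)) f))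
  refine h2.unique (h1.congr_fun fun m => ?_)
  simp only [Function.comp, Equiv.coe_addRight, map_smul]
  rw [mulOp_character_mulOp_character, ← inner_conj_symm, inner_mulOp_left (.character _),
    inner_conj_symm]
  simp only [conj_character]
  have e := mulOp_character_mulOp_character (-(l * β)) (((m + l : ℤ) : ℝ) * β) g
  change inner ℂ (mulOp (character (-(l * β))) (mulOp (character (((m + l : ℤ) : ℝ) * β)) g)) f
    • _ = _
  rw [e, show -(l * β) + ((m + l : ℤ) : ℝ) * β = m * β by push_cast; ring,
    show (l : ℝ) * β + m * β = ((m + l : ℤ) : ℝ) * β by push_cast; ring]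

theorem exists_isFrameOperator_comp {Λ M H : Type*} [NormedAddCommGroup H]
    [InnerProductSpace ℂ H] [CompleteSpace H] {φ : Λ → H} {B : ℝ}
    (hs : ∀ f, Summable fun l => ‖inner ℂ (φ l) f‖ ^ 2)
    (hB : ∀ f, ∑' l, ‖inner ℂ (φ l) f‖ ^ 2 ≤ B * ‖f‖ ^ 2) {e : M → Λ}
    (he : Function.Injective e) :
    ∃ S : H →L[ℂ] H, IsFrameOperator (fun m => φ (e m)) S :=
  exists_isFrameOperator (fun f => (hs f).comp_injective he) fun f =>
    (tsum_comp_le_tsum_of_inj (hs f) (fun _ => sq_nonneg _) he).trans (hB f)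

variable {g : ℤ → L2} {b c d : ℤ → ℝ} {ε : ℝ} {S : L2 →L[ℂ] L2}

/-- The frame operator commutes with the multipliers that are constant along chains. -/
theorem Geometry.frameOperator_commute (G : Geometry b c d ε)
    (hg : ∀ n, ∀ᵐ t, t ∉ Set.Icc (c n) (d n) → g n t = 0)
    (hS : IsFrameOperator (gaborSystem g b) S) {B : ℝ}
    (hs : ∀ f, Summable fun p => ‖inner ℂ (gaborSystem g b p) f‖ ^ 2)
    (hB : ∀ f, ∑' p, ‖inner ℂ (gaborSystem g b p) f‖ ^ 2 ≤ B * ‖f‖ ^ 2)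
    {φ : ℝ → ℂ} (hφ : BddMeas φ) (hinv : ChainInvariant b c d φ) (f : L2) :
    S (mulOp φ f) = mulOp φ (S f) := by
  have hpiece : ∀ n, ∃ T : L2 →L[ℂ] L2,
      IsFrameOperator (fun m : ℤ => mulOp (character (m * b n)) (g n)) T := by
    intro n
    obtain ⟨T, hT⟩ := exists_isFrameOperator_comp hs hB (e := fun m : ℤ => (m, n))
      fun a b hab => (Prod.ext_iff.1 hab).1
    refine ⟨T, ?_⟩
    simpa only [gaborSystem_eq] using hT
  choose T hT using hpiece
  have hsum : ∀ f, HasSum (fun n => T n f) (S f) := by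
    intro f
    have h1 := (Equiv.prodComm ℤ ℤ).hasSum_iff.2 (hS f)
    refine h1.prod_fiberwise fun n => ?_
    refine (hT n f).congr_fun fun m => ?_
    simp only [Function.comp, Equiv.prodComm_apply, Prod.swap_prod_mk, gaborSystem_eq]
  suffices h : ∀ n f, T n (mulOp φ f) = mulOp φ (T n f) by
    refine (hsum _).unique (((hsum f).mapL (mulOp φ)).congr_fun fun n => ?_)
    exact h n f
  intro n f
  set J := Set.Icc (c n) (d n) with hJ
  have bJ : BddMeas (J.indicator 1) := .indicator measurableSet_Icc
  have hgJ : ∀ m : ℤ, mulOp (J.indicator 1) (mulOp (character (m * b n)) (g n))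
      = mulOp (character (m * b n)) (g n) := by
    intro m
    rw [← mulOp_mul bJ (.character _)]
    refine mulOp_congr (bJ.mul (.character _)) (.character _) ?_
    filter_upwards [hg n] with t ht
    by_cases h : t ∈ J
    · simp [h]
    · simp [ht h]
  have hJstar : (fun t => (starRingEnd ℂ) (J.indicator (1 : ℝ → ℂ) t)) = J.indicator 1 := by
    funext t
    by_cases h : t ∈ J <;> simp [h]
  have hTin : ∀ f, T n (mulOp (J.indicator 1) f) = T n f := by
    intro f
    refine (hT n _).unique ((hT n f).congr_fun fun m => ?_)
    congr 1
    have := inner_mulOp_left bJ (mulOp (character (m * b n)) (g n)) f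
    rw [hJstar, hgJ] at this
    exact this.symm
  have hTout : ∀ f, mulOp (J.indicator 1) (T n f) = T n f := by
    intro f
    refine ((hT n f).mapL (mulOp (J.indicator 1))).unique ((hT n f).congr_fun fun m => ?_)
    rw [map_smul, hgJ]
  have hβ := G.shift_pos n
  -- ψ is the 1/b_n-periodic extension of φ from [c_n, c_n + 1/b_n). Since d_n - c_n < 2/b_n, chain
  -- invariance gives ψ = φ almost everywhere on J, and T n sees nothing outside J.
  set ψ : ℝ → ℂ := fun t => φ (toIcoMod hβ (c n) t) with hψ
  have hmod : Measurable (toIcoMod hβ (c n)) := by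
    have : toIcoMod hβ (c n) = fun t => c n + Int.fract ((t - c n) / (b n)⁻¹) * (b n)⁻¹ := by
      funext t; exact toIcoMod_eq_add_fract_mul hβ (c n) t
    rw [this]
    fun_prop
  have bψ : BddMeas ψ := hφ.comp hmod
  have hper : Function.Periodic ψ (b n)⁻¹ := fun t => by
    simp only [hψ, toIcoMod_add_right]
  have hTψ : T n (mulOp ψ f) = mulOp ψ (T n f) := by
    refine commute_mulOp_of_periodic hβ (fun l f => ?_) bψ hper f
    rw [div_inv_eq_mul]
    exact (hT n).commute_character l f
  have heq : ∀ f, mulOp (J.indicator 1) (mulOp φ f) = mulOp (J.indicator 1) (mulOp ψ f) := by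
    intro f
    rw [← mulOp_mul bJ hφ, ← mulOp_mul bJ bψ]
    refine mulOp_congr (bJ.mul hφ) (bJ.mul bψ) ?_
    have h1 : ∀ᵐ t : ℝ, t ≠ c n + (b n)⁻¹ := by simp [ae_iff]
    filter_upwards [h1, ae_ne_all d] with t h1 h2
    by_cases h : t ∈ J
    · have e : ψ t = φ t := by
        rcases lt_or_ge t (c n + (b n)⁻¹) with h3 | h3
        · simp only [hψ]
          rw [(toIcoMod_eq_self hβ).2 ⟨h.1, h3⟩]
        · have h4 := lt_of_le_of_ne h3 h1.symm
          have h5 := lt_of_le_of_ne h.2 (h2 n)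
          have h6 := G.length_le n
          have h7 := G.eps_pos
          have h8 := hinv n (t - (b n)⁻¹) (by linarith) (by linarith)
          rw [sub_add_cancel] at h8
          rw [h8, ← hper.sub_eq t]
          simp only [hψ]
          rw [(toIcoMod_eq_self hβ).2 ⟨by linarith, by linarith⟩]
      rw [e]
    · simp [h]
  rw [← hTin, heq, hTin, hTψ, ← hTout f, mulOp_comm bψ bJ, ← heq, mulOp_comm bJ hφ, hTout]

theorem Geometry.slotProj_gabor (G : Geometry b c d ε)
    (hg : ∀ n, ∀ᵐ t, t ∉ Set.Icc (c n) (d n) → g n t = 0) {o n : ℤ} (h1 : o ≠ n) (h2 : o ≠ n + 1)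
    (m : ℤ) : slotProj c o (gaborSystem g b (m, n)) = 0 := by
  have bo := BddMeas.indicator (measurableSet_Ico (a := c o) (b := c (o + 1)))
  rw [gaborSystem_eq, slotProj, mulOp_comm bo (.character _)]
  have : mulOp ((Set.Ico (c o) (c (o + 1))).indicator 1) (g n) = 0 := by
    have hz : (0 : L2) = mulOp (fun _ => 0) (g n) := by rw [mulOp_zero]; rfl
    rw [hz]
    refine mulOp_congr bo (.const 0) ?_
    filter_upwards [hg n, ae_ne_all d] with t h3 h4
    by_cases ht : t ∈ Set.Ico (c o) (c (o + 1))
    · rw [h3, mul_zero, zero_mul]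
      intro h
      have h5 := (G.slotIndex_eq_iff.2 ht)
      have h6 := lt_of_le_of_ne h.2 (h4 n)
      have h7 := G.right_le_left n
      have h8 : o < n + 2 := G.strictMono.lt_iff_lt.1 (by linarith [ht.1])
      have h9 : n < o + 1 := G.strictMono.lt_iff_lt.1 (by linarith [ht.2, h.1])
      omega
    · simp [ht]
  rw [this, map_zero]

/-- A term with second index n contributes to the block only if both o and i belong to {n, n+1}. -/
theorem Geometry.frameOperator_tridiagonal (G : Geometry b c d ε)
    (hg : ∀ n, ∀ᵐ t, t ∉ Set.Icc (c n) (d n) → g n t = 0)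
    (hS : IsFrameOperator (gaborSystem g b) S) (o i : ℤ) (hoi : 1 < |o - i|) (f : L2) :
    slotProj c o (S (slotProj c i f)) = 0 := by
  refine ((hS _).mapL (slotProj c o)).unique ?_
  convert hasSum_zero with p
  obtain ⟨m, n⟩ := p
  rw [map_smul]
  by_cases ho : o = n ∨ o = n + 1
  · have hi : i ≠ n ∧ i ≠ n + 1 := by
      constructor <;> rintro rfl <;> rcases ho with rfl | rfl <;> simp at hoi
    rw [← G.slotProj_isOrthogonalPartition.symm, G.slotProj_gabor hg hi.1 hi.2, inner_zero_left,
      zero_smul]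
  · push Not at ho
    rw [G.slotProj_gabor hg ho.1 ho.2, smul_zero]

end

/-! ### Translations, block symbols and the Walnut-like representation. -/

section

theorem toLp_smul_eq_mulOp {ω : ℝ → ℂ} (h : BddMeas ω) (f : L2) :
    (h.memLp.toLp ω • f : L2) = mulOp ω f := by
  rw [eq_mulOp_iff h]
  filter_upwards [Lp.coeFn_lpSMul (r := 2) (h.memLp.toLp ω) f, h.memLp.coeFn_toLp] with t h1 h2
  rw [h1, Pi.smul_apply', h2, smul_eq_mul]

theorem coeFn_translation (a : ℝ) (f : L2) : ∀ᵐ t, translation a f t = f (t - a) :=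
  Lp.coeFn_compMeasurePreserving f (measurePreserving_sub_right volume a)

theorem ae_comp_sub {p : ℝ → Prop} (h : ∀ᵐ t, p t) (a : ℝ) : ∀ᵐ t, p (t - a) :=
  (measurePreserving_sub_right volume a).quasiMeasurePreserving.ae h

theorem translation_translation (a a' : ℝ) (f : L2) :
    translation a (translation a' f) = translation (a + a') f := by
  rw [Lp.ext_iff]
  filter_upwards [coeFn_translation a (translation a' f), ae_comp_sub (coeFn_translation a' f) a,
    coeFn_translation (a + a') f] with t h1 h2 h3
  rw [h1, h2, h3, sub_sub]

theorem translation_zero (f : L2) : translation 0 f = f := by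
  rw [Lp.ext_iff]
  filter_upwards [coeFn_translation 0 f] with t h
  rw [h, sub_zero]

theorem translation_mulOp {η : ℝ → ℂ} (hη : BddMeas η) (a : ℝ) (f : L2) :
    translation a (mulOp η f) = mulOp (fun t => η (t - a)) (translation a f) := by
  rw [eq_mulOp_iff (hη.comp (u := fun t => t - a) (measurable_id.sub_const a))]
  filter_upwards [coeFn_translation a (mulOp η f), ae_comp_sub (coeFn_mulOp hη f) a,
    coeFn_translation a f] with t h1 h2 h3
  rw [h1, h2, h3]

theorem bddMeas_slot (c : ℤ → ℝ) (o : ℤ) :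
    BddMeas ((Set.Ico (c o) (c (o + 1))).indicator 1) := .indicator measurableSet_Ico

theorem slotProj_mulOp (c : ℤ → ℝ) (o : ℤ) {η : ℝ → ℂ} (hη : BddMeas η) (f : L2) :
    slotProj c o (mulOp η f) = mulOp η (slotProj c o f) := mulOp_comm (bddMeas_slot c o) hη f

theorem slotProj_mulOp_congr (c : ℤ → ℝ) (o : ℤ) {η θ : ℝ → ℂ} (hη : BddMeas η) (hθ : BddMeas θ)
    (h : ∀ t ∈ Set.Ico (c o) (c (o + 1)), η t = θ t) (f : L2) :
    slotProj c o (mulOp η f) = slotProj c o (mulOp θ f) := by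
  have hb := bddMeas_slot c o
  rw [slotProj, ← mulOp_mul hb hη, ← mulOp_mul hb hθ]
  refine mulOp_congr (hb.mul hη) (hb.mul hθ) (.of_forall fun t => ?_)
  by_cases ht : t ∈ Set.Ico (c o) (c (o + 1))
  · rw [h t ht]
  · simp [ht]

variable {b c d : ℤ → ℝ} {ε : ℝ} {W : L2 →L[ℂ] L2}

namespace Geometry

variable (G : Geometry b c d ε)
include G

theorem coeFn_slotProj (o : ℤ) (f : L2) :
    ∀ᵐ t, slotProj c o f t = if slotIndex c t = o then f t else 0 := by
  filter_upwards [coeFn_mulOp (bddMeas_slot c o) f] with t ht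
  rw [slotProj, ht]
  simp only [G.slotIndex_eq_iff]
  by_cases h : t ∈ Set.Ico (c o) (c (o + 1)) <;> simp [h]

/-! ### Blocks of operators commuting with the chain-invariant multipliers -/

/-- Each block is a multiplier composed with a translation. -/
theorem exists_block_symbol
    (hW : ∀ φ, BddMeas φ → ChainInvariant b c d φ → ∀ f, W (mulOp φ f) = mulOp φ (W f)) (o i : ℤ) :
    ∃ ω, Measurable ω ∧ (∀ t, ‖ω t‖ ≤ ‖W‖) ∧ ∀ f, slotProj c o (W (slotProj c i f))
      = mulOp ω (translation (totalShift b o - totalShift b i) f) := by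
  set s := totalShift b i - totalShift b o with hs
  have hP := G.slotProj_isOrthogonalPartition
  let V : L2 →L[ℂ] L2 := slotProj c o ∘L W ∘L slotProj c i ∘L
    (translation s).toContinuousLinearMap
  have hV : ∀ f, V f = slotProj c o (W (slotProj c i (translation s f))) := fun f => rfl
  have hVn : ‖V‖ ≤ ‖W‖ := by
    refine V.opNorm_le_bound (norm_nonneg _) fun f => ?_
    rw [hV]
    refine (hP.norm_apply_le _ _).trans ((W.le_opNorm _).trans ?_)
    gcongr
    exact (hP.norm_apply_le _ _).trans_eq ((translation s).norm_map f)
  -- Moving η past the translation gives η(t - s), which on slot i equals η(u + σ(o)). That function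
  -- is chain-invariant, so it passes through W, and on slot o it equals η again.
  obtain ⟨ω, h1, h2, h3⟩ := exists_symbol V fun η hη f => by
    have hu : BddMeas fun t => η (unshifted b c t + totalShift b o) :=
      hη.comp (G.measurable_unshifted.add_const _)
    rw [hV, hV, translation_mulOp hη, slotProj_mulOp_congr c i
      (hη.comp (u := fun t => t - s) (measurable_id.sub_const s)) hu, slotProj_mulOp _ _ hu,
      hW _ hu (G.chainInvariant_comp_unshifted fun x => η (x + totalShift b o)),
      slotProj_mulOp_congr c o hu hη, slotProj_mulOp _ _ hη]
    · intro t ht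
      rw [unshifted, G.slotIndex_eq_iff.2 ht, sub_add_cancel]
    · intro t ht
      simp only [unshifted, G.slotIndex_eq_iff.2 ht, hs]
      congr 1; ring
  refine ⟨ω, h1, fun t => (h2 t).trans hVn, fun f => ?_⟩
  rw [← h3, hV, translation_translation, hs, sub_add_sub_cancel, sub_self, translation_zero]

/-- If `f` vanishes on the left of a cut link, then so does its image. -/
theorem vanish_cut_left
    (hW : ∀ φ, BddMeas φ → ChainInvariant b c d φ → ∀ f, W (mulOp φ f) = mulOp φ (W f))
    (m : ℤ) {s : Set ℝ} (hsm : MeasurableSet s)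
    (hs : ∀ u ∈ s, u ≤ c m - totalShift b m ∨ d m - totalShift b (m + 1) ≤ u) {f : L2}
    (hf : ∀ᵐ t, slotIndex c t ≤ m → unshifted b c t ∈ s → f t = 0) :
    ∀ᵐ t, slotIndex c t ≤ m → unshifted b c t ∈ s → W f t = 0 := by
  set A := {t | slotIndex c t ≤ m ∧ unshifted b c t ∈ s} with hA
  have hAm : MeasurableSet A :=
    (G.measurable_slotIndex (MeasurableSet.of_discrete (s := Set.Iic m))).inter
      (G.measurable_unshifted hsm)
  have bA : BddMeas (A.indicator 1) := .indicator hAm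
  have h0 : mulOp (A.indicator 1) f = 0 := by
    symm
    rw [eq_mulOp_iff bA]
    filter_upwards [hf, Lp.coeFn_zero ℂ 2 (volume : Measure ℝ)] with t h1 h2
    rw [h2]
    by_cases ht : t ∈ A
    · rw [h1 ht.1 ht.2, mul_zero]; rfl
    · simp [ht]
  have h1 := hW _ bA (G.chainInvariant_cut_left m hs) f
  rw [h0, map_zero, eq_mulOp_iff bA] at h1
  filter_upwards [h1, Lp.coeFn_zero ℂ 2 (volume : Measure ℝ)] with t h1 h2 h3 h4
  have ht : t ∈ A := ⟨h3, h4⟩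
  rw [h2, Set.indicator_of_mem ht] at h1
  simpa using h1.symm

/-- If `f` vanishes on the right of a cut link, then so does its image. -/
theorem vanish_cut_right
    (hW : ∀ φ, BddMeas φ → ChainInvariant b c d φ → ∀ f, W (mulOp φ f) = mulOp φ (W f))
    (m : ℤ) {s : Set ℝ} (hsm : MeasurableSet s)
    (hs : ∀ u ∈ s, u ≤ c m - totalShift b m ∨ d m - totalShift b (m + 1) ≤ u) {f : L2}
    (hf : ∀ᵐ t, m < slotIndex c t → unshifted b c t ∈ s → f t = 0) :
    ∀ᵐ t, m < slotIndex c t → unshifted b c t ∈ s → W f t = 0 := by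
  set A := {t | m < slotIndex c t ∧ unshifted b c t ∈ s} with hA
  have hAm : MeasurableSet A :=
    (G.measurable_slotIndex (MeasurableSet.of_discrete (s := Set.Ioi m))).inter
      (G.measurable_unshifted hsm)
  have bA : BddMeas (A.indicator 1) := .indicator hAm
  have h0 : mulOp (A.indicator 1) f = 0 := by
    symm
    rw [eq_mulOp_iff bA]
    filter_upwards [hf, Lp.coeFn_zero ℂ 2 (volume : Measure ℝ)] with t h1 h2
    rw [h2]
    by_cases ht : t ∈ A
    · rw [h1 ht.1 ht.2, mul_zero]; rfl
    · simp [ht]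
  have h1 := hW _ bA (G.chainInvariant_cut_right m hs) f
  rw [h0, map_zero, eq_mulOp_iff bA] at h1
  filter_upwards [h1, Lp.coeFn_zero ℂ 2 (volume : Measure ℝ)] with t h1 h2 h3 h4
  have ht : t ∈ A := ⟨h3, h4⟩
  rw [h2, Set.indicator_of_mem ht] at h1
  simpa using h1.symm

/-- A chain leading from the slots above m to a slot at or below m must use link m, which is missing
once u ≥ d m - σ(m+1). -/
theorem vanish_cut_left_right_end
    (hW : ∀ φ, BddMeas φ → ChainInvariant b c d φ → ∀ f, W (mulOp φ f) = mulOp φ (W f))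
    (m : ℤ) {f : L2} (hf : ∀ᵐ t, slotIndex c t ≤ m → f t = 0) :
    ∀ᵐ t, slotIndex c t ≤ m → d m - totalShift b (m + 1) ≤ unshifted b c t → W f t = 0 :=
  G.vanish_cut_left hW m measurableSet_Ici (fun _ h => Or.inr h) (hf.mono fun _ h h1 _ => h h1)

theorem vanish_cut_right_left_end
    (hW : ∀ φ, BddMeas φ → ChainInvariant b c d φ → ∀ f, W (mulOp φ f) = mulOp φ (W f))
    (m : ℤ) {f : L2} (hf : ∀ᵐ t, m < slotIndex c t → f t = 0) :
    ∀ᵐ t, m < slotIndex c t → unshifted b c t ≤ c m - totalShift b m → W f t = 0 :=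
  G.vanish_cut_right hW m measurableSet_Iic (fun _ h => Or.inl h) (hf.mono fun _ h h1 _ => h h1)

theorem vanish_cut_right_right_end
    (hW : ∀ φ, BddMeas φ → ChainInvariant b c d φ → ∀ f, W (mulOp φ f) = mulOp φ (W f))
    (m : ℤ) {f : L2}
    (hf : ∀ᵐ t, m < slotIndex c t → d m - totalShift b (m + 1) ≤ unshifted b c t → f t = 0) :
    ∀ᵐ t, m < slotIndex c t → d m - totalShift b (m + 1) ≤ unshifted b c t → W f t = 0 :=
  G.vanish_cut_right hW m measurableSet_Ici (fun _ h => Or.inr h) hf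

end Geometry

/-- The output and input slots of the term `(n, k)` of the Walnut-like representation. -/
def walnutSlots : OffDiag ≃ {q : ℤ × ℤ // q.1 ≠ q.2} where
  toFun p := ⟨(if 0 < p.1.2 then p.1.1 else p.1.1 + 1,
    (if 0 < p.1.2 then p.1.1 else p.1.1 + 1) + p.1.2), by
      have := p.2; simp only; split_ifs <;> omega⟩
  invFun q := ⟨(if q.1.1 < q.1.2 then q.1.1 else q.1.1 - 1, q.1.2 - q.1.1), by
      have := q.2; simp only; omega⟩
  left_inv := by
    rintro ⟨⟨n, k⟩, hk⟩
    simp only at hk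
    ext <;> simp only <;> split_ifs <;> omega
  right_inv := by
    rintro ⟨⟨o, i⟩, hq⟩
    simp only at hq
    ext <;> simp only <;> split_ifs <;> omega

theorem walnutShift_eq (b : ℤ → ℝ) (p : OffDiag) :
    totalShift b (walnutSlots p).1.1 - totalShift b (walnutSlots p).1.2 = walnutShift b p := by
  obtain ⟨⟨n, k⟩, hk⟩ := p
  simp only at hk
  simp only [walnutSlots, walnutShift, Equiv.coe_fn_mk]
  split_ifs with h
  · rw [Bplus_eq, show (k.natAbs : ℤ) = k by omega]; ring
  · rw [Bminus_eq, show (k.natAbs : ℤ) = -k by omega, sub_neg_eq_add]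

theorem measurableSet_walnutInterval (b c d : ℤ → ℝ) (p : OffDiag) :
    MeasurableSet (walnutInterval b c d p) := by
  unfold walnutInterval
  split_ifs
  exacts [measurableSet_Iminus .., measurableSet_Iplus ..]

theorem isClosed_walnutInterval (b c d : ℤ → ℝ) (p : OffDiag) :
    IsClosed (walnutInterval b c d p) := by
  unfold walnutInterval
  split_ifs
  exacts [isClosed_Icc, isClosed_Icc]

namespace Geometry

variable (G : Geometry b c d ε)
include G

/-- For k > 0 the output slot is n, whose own start gives the left end c n, so only the right end of
link n+k-1 has to be cut. For k < 0 the output slot is n+1 and neither end comes from the slot: the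
left end is a cut at link n+1+k, the right end d n a cut at link n. -/
theorem vanish_off_walnutInterval
    (hW : ∀ φ, BddMeas φ → ChainInvariant b c d φ → ∀ f, W (mulOp φ f) = mulOp φ (W f))
    (p : OffDiag) (f : L2) :
    ∀ᵐ t, t ∉ walnutInterval b c d p →
      slotProj c (walnutSlots p).1.1 (W (slotProj c (walnutSlots p).1.2 f)) t = 0 := by
  obtain ⟨⟨n, k⟩, hk⟩ := p
  simp only at hk
  by_cases h : 0 < k
  · simp only [walnutSlots, walnutInterval, Equiv.coe_fn_mk, if_pos h]
    have e : ((k.natAbs : ℕ) : ℤ) = k := by omega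
    have h0 : ∀ᵐ t, slotIndex c t ≤ n + k - 1 → slotProj c (n + k) f t = 0 := by
      filter_upwards [G.coeFn_slotProj (n + k) f] with t ht h1
      rw [ht, if_neg (by omega)]
    filter_upwards [G.vanish_cut_left_right_end hW _ h0,
      G.coeFn_slotProj n (W (slotProj c (n + k) f))] with t h1 h2 h3
    rw [h2]
    split_ifs with h4
    · refine h1 (by omega) ?_
      have h5 := (G.slotIndex_eq_iff.1 h4).1
      rw [Iminus, Bplus_eq, e, Set.mem_Icc, not_and, not_le] at h3
      have h6 := h3 h5
      rw [unshifted, h4, sub_add_cancel]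
      linarith
    · rfl
  · simp only [walnutSlots, walnutInterval, Equiv.coe_fn_mk, if_neg h]
    have e : ((k.natAbs : ℕ) : ℤ) = -k := by omega
    have h0 : ∀ m, n + 1 + k ≤ m → ∀ᵐ t, m < slotIndex c t → slotProj c (n + 1 + k) f t = 0 := by
      intro m hm
      filter_upwards [G.coeFn_slotProj (n + 1 + k) f] with t ht h1
      rw [ht, if_neg (by omega)]
    filter_upwards [G.vanish_cut_right_left_end hW _ (h0 (n + 1 + k) le_rfl),
      G.vanish_cut_right_right_end hW _ ((h0 n (by omega)).mono fun t ht h _ => ht h),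
      G.coeFn_slotProj (n + 1) (W (slotProj c (n + 1 + k) f))] with t h1 h1' h2 h3
    rw [h2]
    split_ifs with h4
    · rw [Iplus, Bminus_eq, e, Set.mem_Icc, not_and_or, not_le, not_le,
        show n - -k + 1 = n + 1 + k by ring, show n + 1 - -k = n + 1 + k by ring] at h3
      rw [unshifted, h4] at h1 h1'
      rcases h3 with h3 | h3
      · exact h1 (by omega) (by linarith)
      · exact h1' (by omega) (by linarith)
    · rfl

/-- The Walnut-like representation of a bounded operator with summable diagonals that commutes
with the chain-invariant multipliers. -/
theorem exists_walnut
    (hW : ∀ φ, BddMeas φ → ChainInvariant b c d φ → ∀ f, W (mulOp φ f) = mulOp φ (W f))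
    {δ : ℤ → ℝ} (hδ : Summable δ)
    (hWδ : ∀ o i x, ‖slotProj c o (W (slotProj c i x))‖ ≤ δ (i - o) * ‖x‖) :
    ∃ (ω₀ : Linf) (ω : OffDiag → Linf),
      IsWalnutLikeRepresentation (Λ := Option OffDiag) ⊤ W
        (fun o => o.elim ω₀ ω) (fun o => o.elim 0 (walnutShift b)) ∧
      ∀ p, essSupport (ω p) ⊆ walnutInterval b c d p := by
  have hP := G.slotProj_isOrthogonalPartition
  choose w hwm hwb hw using G.exists_block_symbol hW
  -- The diagonal blocks involve no translation, so their symbols are glued slot by slot into the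
  -- single ω₀; the common bound ‖W‖ keeps it bounded.
  have b₀ : BddMeas fun t => w (slotIndex c t) (slotIndex c t) t := by
    refine ⟨?_, ‖W‖, fun t => hwb _ _ t⟩
    have : Measurable fun q : ℤ × ℝ => w q.1 q.1 q.2 :=
      measurable_from_prod_countable_right fun n => hwm n n
    exact this.comp (G.measurable_slotIndex.prodMk measurable_id)
  have bw : ∀ o i, BddMeas (w o i) := fun o i => ⟨hwm o i, ‖W‖, hwb o i⟩
  have bI : ∀ p, BddMeas ((walnutInterval b c d p).indicator 1) := fun p =>
    .indicator (measurableSet_walnutInterval b c d p)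
  -- The block output vanishes off the interval, so truncating the symbol there leaves the term
  -- unchanged and gives the required support.
  have bω : ∀ p : OffDiag, BddMeas fun t => (walnutInterval b c d p).indicator 1 t *
      w (walnutSlots p).1.1 (walnutSlots p).1.2 t := fun p => (bI p).mul (bw _ _)
  refine ⟨b₀.memLp.toLp, fun p => (bω p).memLp.toLp, ⟨dense_univ, fun f _ => ?_⟩, fun p => ?_⟩
  · have hall := hP.hasSum_blocks hδ hWδ f
    have hdiag : HasSum (fun o : ℤ => slotProj c o (W (slotProj c o f)))
        (mulOp (fun t => w (slotIndex c t) (slotIndex c t) t) f) := by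
      refine (hP.hasSum _).congr_fun fun o => ?_
      rw [← hP.proj, hw, sub_self, translation_zero]
      refine slotProj_mulOp_congr c o (bw o o) b₀ (fun t ht => ?_) f
      rw [G.slotIndex_eq_iff.2 ht]
    have hoff : HasSum (fun q : {q : ℤ × ℤ // q.1 ≠ q.2} =>
        slotProj c q.1.1 (W (slotProj c q.1.2 f)))
        (W f - mulOp (fun t => w (slotIndex c t) (slotIndex c t) t) f) := by
      have h1 := (hall.summable.subtype {q | q.1 ≠ q.2}).hasSum
      have h2 : HasSum ((fun q : ℤ × ℤ => slotProj c q.1 (W (slotProj c q.2 f))) ∘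
          ((↑) : ({q | q.1 ≠ q.2}ᶜ : Set (ℤ × ℤ)) → ℤ × ℤ))
          (mulOp (fun t => w (slotIndex c t) (slotIndex c t) t) f) := by
        let e : ℤ ≃ ({q | q.1 ≠ q.2}ᶜ : Set (ℤ × ℤ)) :=
          { toFun := fun o => ⟨(o, o), by simp⟩
            invFun := fun q => q.1.1
            left_inv := fun o => rfl
            right_inv := by
              rintro ⟨⟨o, i⟩, hq⟩
              obtain rfl : o = i := by simpa using hq
              rfl }
        exact e.hasSum_iff.1 hdiag
      have h3 := (h1.add_compl h2).unique hall
      rw [← h3, add_sub_cancel_right]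
      exact h1
    have hterm : HasSum (fun p : OffDiag =>
        ((bω p).memLp.toLp _ • translation (walnutShift b p) f : L2))
        (W f - mulOp (fun t => w (slotIndex c t) (slotIndex c t) t) f) := by
      refine (walnutSlots.hasSum_iff.2 hoff).congr_fun fun p => ?_
      rw [toLp_smul_eq_mulOp (bω p), mulOp_mul (bI p) (bw _ _), ← walnutShift_eq, ← hw, Function.comp]
      symm
      rw [eq_mulOp_iff (bI p)]
      filter_upwards [G.vanish_off_walnutInterval hW p f] with t ht
      by_cases h : t ∈ walnutInterval b c d p
      · simp [h]
      · simp [h, ht h]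
    have h1 : HasSum (fun o : Option OffDiag => o.elim (0 : L2) fun p =>
        ((bω p).memLp.toLp _ • translation (walnutShift b p) f : L2))
        (W f - mulOp (fun t => w (slotIndex c t) (slotIndex c t) t) f) := by
      refine ((Option.some_injective OffDiag).hasSum_iff fun o ho => ?_).1 hterm
      cases o with
      | none => rfl
      | some p => exact absurd ⟨p, rfl⟩ ho
    have h2 : HasSum (fun o : Option OffDiag => o.elim
        (mulOp (fun t => w (slotIndex c t) (slotIndex c t) t) f) fun _ => 0)
        (mulOp (fun t => w (slotIndex c t) (slotIndex c t) t) f) := by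
      refine hasSum_single (f := fun o : Option OffDiag => o.elim
        (mulOp (fun t => w (slotIndex c t) (slotIndex c t) t) f) fun _ => 0) none fun o ho => ?_
      cases o with
      | none => exact absurd rfl ho
      | some p => rfl
    have h3 := h1.add h2
    rw [sub_add_cancel] at h3
    refine h3.congr_fun fun o => ?_
    cases o with
    | none =>
      simp only [Option.elim_none, zero_add]
      rw [translation_zero, toLp_smul_eq_mulOp b₀]
    | some p => simp only [Option.elim_some, add_zero]
  · refine essSupport_subset_of_ae (isClosed_walnutInterval b c d p) ?_
    filter_upwards [(bω p).memLp.coeFn_toLp] with t ht h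
    rw [ht, Set.indicator_of_notMem h, zero_mul]

end Geometry

end

/-! ### Size of the intervals, and support and phases of the dual elements. -/

section

theorem character_natural_shift {β : ℝ} (hβ : β ≠ 0) (m : ℤ) (t : ℝ) :
    character (m * β) (t - β⁻¹) = character (m * β) t := by
  have h : (β : ℂ) ≠ 0 := by exact_mod_cast hβ
  refine Eq.trans ?_ (Complex.exp_periodic.sub_int_mul_eq m)
  rw [character]
  congr 1
  push_cast
  field_simp

variable {g : ℤ → L2} {b c d : ℤ → ℝ} {ε : ℝ} {W : L2 →L[ℂ] L2}

namespace Geometry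

variable (G : Geometry b c d ε)
include G

/-! ### The intervals -/

/-- The k - 1 index steps from n-k+1 to n gain ε each. This and the companion for `Iminus` bound
both lengths by d_n - c_n - 1/b_n - (k-1)ε, from which (iv) follows. -/
theorem mem_Iplus {n : ℤ} {k : ℕ} (hk : 1 ≤ k) {t : ℝ} (ht : t ∈ Iplus b c d n k) :
    c n + (b n)⁻¹ + (k - 1) * ε ≤ t ∧ t ≤ d n := by
  obtain ⟨j, rfl⟩ : ∃ j, k = j + 1 := ⟨k - 1, by omega⟩
  rw [Iplus, Bminus_eq, Set.mem_Icc] at ht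
  have h1 := G.left_sub_totalShift_le (n - j) j
  rw [sub_add_cancel] at h1
  have h2 := totalShift_succ b n
  push_cast at ht ⊢
  rw [show n - ((j : ℤ) + 1) + 1 = n - j by ring, show n + 1 - ((j : ℤ) + 1) = n - j by ring] at ht
  exact ⟨by linarith, ht.2⟩

theorem mem_Iminus {n : ℤ} {k : ℕ} (hk : 1 ≤ k) {t : ℝ} (ht : t ∈ Iminus b c d n k) :
    c n ≤ t ∧ t ≤ d n - (b n)⁻¹ - (k - 1) * ε := by
  obtain ⟨j, rfl⟩ : ∃ j, k = j + 1 := ⟨k - 1, by omega⟩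
  rw [Iminus, Bplus_eq, Set.mem_Icc] at ht
  have h1 := G.right_sub_totalShift_le n j
  have h2 := totalShift_succ b n
  push_cast at ht ⊢
  rw [show n + ((j : ℤ) + 1) - 1 = n + j by ring, ← add_assoc] at ht
  exact ⟨ht.1, by linarith⟩

theorem slotIndex_of_mem_Iplus {n : ℤ} {k : ℕ} (hk : 1 ≤ k) {t : ℝ} (ht : t ∈ Iplus b c d n k)
    (htd : t ≠ d n) : slotIndex c t = n + 1 := by
  obtain ⟨h1, h2⟩ := G.mem_Iplus hk ht
  have h3 : (0 : ℝ) ≤ (k - 1) * ε :=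
    mul_nonneg (sub_nonneg.2 (by exact_mod_cast hk)) G.eps_pos.le
  rw [G.slotIndex_eq_iff, add_assoc]
  have := lt_of_le_of_ne h2 htd
  exact ⟨by linarith [G.left_le n, G.eps_pos], this.trans_le (G.right_le_left n)⟩

theorem slotIndex_of_mem_Iminus {n : ℤ} {k : ℕ} (hk : 1 ≤ k) {t : ℝ}
    (ht : t ∈ Iminus b c d n k) : slotIndex c t = n := by
  obtain ⟨h1, h2⟩ := G.mem_Iminus hk ht
  have h3 : (0 : ℝ) ≤ (k - 1) * ε :=
    mul_nonneg (sub_nonneg.2 (by exact_mod_cast hk)) G.eps_pos.le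
  rw [G.slotIndex_eq_iff]
  have h4 := G.right_le (n - 1)
  have h5 := G.right_le_left (n - 1)
  rw [show n - 1 + 1 = n by ring] at h4
  rw [show n - 1 + 2 = n + 1 by ring] at h5
  exact ⟨h1, by linarith [G.eps_pos]⟩

theorem eq_empty_of_lt {n : ℤ} {k : ℕ} (hk : 1 ≤ k)
    (h : d n - c n - (b n)⁻¹ < (k - 1) * ε) :
    Iplus b c d n k = ∅ ∧ Iminus b c d n k = ∅ := by
  constructor <;> refine Set.eq_empty_of_forall_notMem fun t ht => ?_
  · have := G.mem_Iplus hk ht; linarith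
  · have := G.mem_Iminus hk ht; linarith

theorem subsingleton_of_le {n : ℤ} {k : ℕ} (hk : 1 ≤ k)
    (h : d n - c n - (b n)⁻¹ ≤ (k - 1) * ε) :
    (Iplus b c d n k).Subsingleton ∧ (Iminus b c d n k).Subsingleton := by
  constructor <;> intro t ht s hs
  · have := G.mem_Iplus hk ht; have := G.mem_Iplus hk hs; linarith
  · have := G.mem_Iminus hk ht; have := G.mem_Iminus hk hs; linarith

theorem exists_forall_eq_empty (n : ℤ) : ∃ k₀ : ℕ, 1 ≤ k₀ ∧ ∀ k : ℕ, k₀ ≤ k →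
    Iplus b c d n k = ∅ ∧ Iminus b c d n k = ∅ := by
  obtain ⟨K, hK⟩ := exists_nat_gt ((d n - c n - (b n)⁻¹) / ε)
  rw [div_lt_iff₀ G.eps_pos] at hK
  refine ⟨K + 1, by omega, fun k hk => G.eq_empty_of_lt (by omega) (hK.trans_le ?_)⟩
  have : (K : ℝ) + 1 ≤ k := by exact_mod_cast hk
  have := G.eps_pos
  gcongr
  linarith

/-- Only finitely many intervals occur in the support of a dual element. -/
theorem exists_forall_dual_eq_empty (n : ℤ) : ∃ K : ℕ, ∀ k : ℕ, K ≤ k → 1 ≤ k →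
    Iminus b c d (n - k) k = ∅ ∧ Iplus b c d (n + k) k = ∅ := by
  -- The first index n ∓ k varies with k, so (iv) does not apply directly. But I⁻_{n-k,k} is a
  -- translate of I⁺_{n-1,k}, and I⁺_{n+k,k} of I⁻_{n+1,k}, since they have the same ends in the
  -- coordinate u.
  obtain ⟨k₁, -, h₁⟩ := G.exists_forall_eq_empty (n - 1)
  obtain ⟨k₂, -, h₂⟩ := G.exists_forall_eq_empty (n + 1)
  refine ⟨max k₁ k₂, fun k hk hk1 => ⟨?_, ?_⟩⟩
  · have h := (h₁ k (le_trans (le_max_left _ _) hk)).1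
    rw [Iplus, Set.Icc_eq_empty_iff, Bminus_eq] at h
    rw [Iminus, Set.Icc_eq_empty_iff, Bplus_eq]
    rw [sub_add_cancel, show n - 1 - (k : ℤ) + 1 = n - k by ring] at h
    rw [sub_add_cancel]
    intro h'
    exact h (by linarith)
  · have h := (h₂ k (le_trans (le_max_right _ _) hk)).2
    rw [Iminus, Set.Icc_eq_empty_iff, Bplus_eq] at h
    rw [Iplus, Set.Icc_eq_empty_iff, Bminus_eq]
    rw [show n + 1 + (k : ℤ) - 1 = n + k by ring] at h
    rw [show n + (k : ℤ) - k + 1 = n + 1 by ring, show n + (k : ℤ) + 1 - k = n + 1 by ring]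
    rw [show n + 1 + (k : ℤ) = n + k + 1 by ring] at h
    intro h'
    exact h (by linarith)

/-- Only finitely many members of the union are nonempty. Closedness is what turns almost everywhere
vanishing into a bound on the essential support. -/
theorem isClosed_dualSupport (n : ℤ) : IsClosed (Izero c d n ∪ ⋃ k : ℕ+,
    (Iminus b c d (n - (k : ℕ)) k ∪ Iplus b c d (n + (k : ℕ)) k)) := by
  obtain ⟨K, hK⟩ := G.exists_forall_dual_eq_empty n
  refine IsClosed.union isClosed_Icc ?_
  refine LocallyFinite.isClosed_iUnion (fun x => ⟨Set.univ, Filter.univ_mem, ?_⟩)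
    fun k => isClosed_Icc.union isClosed_Icc
  have hfin : {k : ℕ+ | (k : ℕ) < K}.Finite := (Set.finite_lt_nat K).preimage
    PNat.coe_injective.injOn
  refine hfin.subset fun k hk => ?_
  by_contra hlt
  obtain ⟨h1, h2⟩ := hK k (not_lt.1 hlt) k.2
  obtain ⟨y, hy | hy, -⟩ := hk
  · exact Set.notMem_empty y (h1 ▸ hy)
  · exact Set.notMem_empty y (h2 ▸ hy)

/-! ### The dual elements -/

/-- The image of a function supported in `[c n, d n]` under an operator commuting with the
chain-invariant multipliers is supported in the intervals reached by chains. -/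
theorem vanish_off_dualSupport
    (hW : ∀ φ, BddMeas φ → ChainInvariant b c d φ → ∀ f, W (mulOp φ f) = mulOp φ (W f))
    (n : ℤ) {f : L2} (hf : ∀ᵐ t, t ∉ Set.Icc (c n) (d n) → f t = 0) :
    ∀ᵐ t, t ∉ Izero c d n ∪ ⋃ k : ℕ+,
      (Iminus b c d (n - (k : ℕ)) k ∪ Iplus b c d (n + (k : ℕ)) k) → W f t = 0 := by
  have hL : ∀ᵐ t, slotIndex c t ≤ n - 1 → f t = 0 := by
    filter_upwards [hf] with t ht h
    refine ht fun h' => ?_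
    have h1 := (G.slotIndex_eq_iff.1 (rfl : slotIndex c t = slotIndex c t)).2
    have h2 : n < slotIndex c t + 1 := G.strictMono.lt_iff_lt.1 (h'.1.trans_lt h1)
    omega
  have hR : ∀ m, n + 1 ≤ m → ∀ᵐ t, m < slotIndex c t → f t = 0 := by
    intro m hm
    filter_upwards [hf, ae_ne_all d] with t ht hd h
    refine ht fun h' => ?_
    have h1 := (G.slotIndex_eq_iff.1 (rfl : slotIndex c t = slotIndex c t)).1
    have h2 := G.right_le_left n
    have h3 : slotIndex c t < n + 2 := G.strictMono.lt_iff_lt.1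
      (h1.trans_lt ((lt_of_le_of_ne h'.2 (hd n)).trans_le h2))
    omega
  -- In slot n+1 the condition on u reads d n ≤ t, where f vanishes apart from the null point t = d
  -- n.
  have hN : ∀ᵐ t, n < slotIndex c t → d n - totalShift b (n + 1) ≤ unshifted b c t → f t = 0 := by
    filter_upwards [hf, ae_ne_all d, hR _ le_rfl] with t ht hd hr h h'
    rcases (show n + 1 ≤ slotIndex c t from h).lt_or_eq with h1 | h1
    · exact hr h1
    · refine ht fun h2 => hd n (le_antisymm h2.2 ?_)
      rw [unshifted, ← h1] at h'
      linarith
  have a2 := ae_all_iff.2 fun m : ℤ => Filter.eventually_imp_distrib_left.2 fun hm : n + 1 ≤ m =>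
    G.vanish_cut_right_left_end hW m (hR m hm)
  have a3 := ae_all_iff.2 fun m : ℤ => Filter.eventually_imp_distrib_left.2 fun hm : n + 1 ≤ m =>
    G.vanish_cut_right_right_end hW m ((hR m hm).mono fun _ h h1 _ => h h1)
  filter_upwards [G.vanish_cut_left_right_end hW (n - 1) hL, a2, a3,
    G.vanish_cut_right_right_end hW n hN] with t h1 h2 h3 h4 ht
  simp only [Set.mem_union, Set.mem_iUnion, not_or, not_exists] at ht
  obtain ⟨ht0, htk⟩ := ht
  obtain ⟨hs1, hs2⟩ := G.slotIndex_eq_iff.1 (rfl : slotIndex c t = slotIndex c t)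
  set j := slotIndex c t with hj
  rw [unshifted, ← hj] at h1 h4
  have hu : unshifted b c t = t - totalShift b j := rfl
  rcases lt_trichotomy j n with hlt | heq | hgt
  · obtain ⟨k, hk⟩ : ∃ k : ℕ, n - k = j := ⟨(n - j).toNat, by omega⟩
    have h := (htk ⟨k, by omega⟩).1
    simp only [PNat.mk_coe] at h
    rw [hk, Iminus, Bplus_eq, show j + (k : ℤ) = n by omega, Set.mem_Icc, not_and, not_le] at h
    refine h1 (by omega) ?_
    have := h hs1
    rw [sub_add_cancel]
    linarith
  · exact absurd ⟨heq ▸ hs1, by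
      rw [heq] at hs2
      linarith [G.left_succ_lt n, G.eps_pos]⟩ ht0
  · rcases (show n + 1 ≤ j from hgt).lt_or_eq with hgt' | heq
    · obtain ⟨k, hk⟩ : ∃ k : ℕ, n + k + 1 = j := ⟨(j - n - 1).toNat, by omega⟩
      have h := (htk ⟨k, by omega⟩).2
      simp only [PNat.mk_coe] at h
      rw [Iplus, Bminus_eq, hk, show n + (k : ℤ) - k + 1 = n + 1 by ring,
        show j - (k : ℤ) = n + 1 by omega, Set.mem_Icc, not_and_or, not_le, not_le] at h
      rcases h with h | h
      · exact h2 (n + 1) le_rfl (by omega) (by rw [hu]; linarith)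
      · exact h3 (n + k) (by omega) (by omega) (by rw [hu, hk]; linarith)
    · refine h4 hgt ?_
      rw [Izero, Set.mem_Icc, not_and, not_le] at ht0
      have h5 := ht0 (by
        rw [← heq] at hs1
        linarith [G.step n, G.eps_pos])
      rw [← heq]
      linarith

theorem slotIndex_of_mem_Icc {n : ℤ} {t : ℝ} (ht : t ∈ Set.Icc (c n) (d n)) (htd : t ≠ d n) :
    slotIndex c t = n ∨ slotIndex c t = n + 1 := by
  obtain ⟨h1, h2⟩ := G.slotIndex_eq_iff.1 (rfl : slotIndex c t = slotIndex c t)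
  have h3 := lt_of_le_of_ne ht.2 htd
  have h4 := G.right_le_left n
  have h5 : slotIndex c t < n + 2 := G.strictMono.lt_iff_lt.1 (by linarith)
  have h6 : n < slotIndex c t + 1 := G.strictMono.lt_iff_lt.1 (by linarith [ht.1])
  omega

/-- The chain-invariant extension of a natural modulation of the `n`-th window. -/
theorem character_unshifted {n : ℤ} (m : ℤ) {t : ℝ}
    (ht : slotIndex c t = n ∨ slotIndex c t = n + 1) :
    character (m * b n) (unshifted b c t + totalShift b n) = character (m * b n) t := by
  have hb : b n ≠ 0 := fun h => by
    have := G.shift_pos n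
    simp [h] at this
  rcases ht with h | h
  · rw [unshifted, h, sub_add_cancel]
  · rw [unshifted, h, totalShift_succ, ← character_natural_shift hb m t]
    congr 1; ring

/-- The modulation itself need not be chain-invariant. On the slots n and n+1 it agrees with a
function of u, because the two arguments differ by 0 or by the period 1/b_n; in that form it can be
pulled through W. -/
theorem gaborSystem_eq_mulOp_unshifted {n : ℤ}
    (hg : ∀ᵐ t, t ∉ Set.Icc (c n) (d n) → g n t = 0) (m : ℤ) :
    gaborSystem g b (m, n) = mulOp (fun t => character (m * b n) (unshifted b c t + totalShift b n))
      (gaborSystem g b (0, n)) := by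
  have bθ : BddMeas fun t => character (m * b n) (unshifted b c t + totalShift b n) :=
    (BddMeas.character _).comp (G.measurable_unshifted.add_const _)
  rw [gaborSystem_eq, gaborSystem_eq]
  refine mulOp_congr (.character _) bθ ?_
  filter_upwards [hg, ae_ne_all d, coeFn_mulOp (BddMeas.character (((0 : ℤ) : ℝ) * b n)) (g n)]
    with t h1 h2 h3
  have h4 : character (((0 : ℤ) : ℝ) * b n) t = 1 := by simp [character]
  rw [h3, h4, one_mul]
  by_cases h : t ∈ Set.Icc (c n) (d n)
  · rw [G.character_unshifted m (G.slotIndex_of_mem_Icc h (h2 n))]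
  · rw [h1 h, mul_zero, mul_zero]

end Geometry

/-- The multiplier of the `k`-th phase term. -/
def phaseSymbol (b c d : ℤ → ℝ) (m n : ℤ) (k : ℕ+) (t : ℝ) : ℂ :=
  Complex.exp (2 * Real.pi * Complex.I * m * b n * Bplus b (n - (k : ℕ)) k) *
      (Iminus b c d (n - (k : ℕ)) k).indicator 1 t +
    Complex.exp (-(2 * Real.pi * Complex.I * m * b n * Bminus b (n + (k : ℕ)) k)) *
      (Iplus b c d (n + (k : ℕ)) k).indicator 1 t

theorem bddMeas_phaseSymbol (b c d : ℤ → ℝ) (m n : ℤ) (k : ℕ+) :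
    BddMeas (phaseSymbol b c d m n k) :=
  ((BddMeas.const _).mul (.indicator (measurableSet_Iminus ..))).add
    ((BddMeas.const _).mul (.indicator (measurableSet_Iplus ..)))

theorem phaseTerm_eq_mulOp (b c d : ℤ → ℝ) (m n : ℤ) (f : L2) (k : ℕ+) :
    phaseTerm b c d m n f k = mulOp (phaseSymbol b c d m n k) f := by
  have b1 := BddMeas.indicator (measurableSet_Iminus b c d (n - (k : ℕ)) k)
  have b2 := BddMeas.indicator (measurableSet_Iplus b c d (n + (k : ℕ)) k)
  unfold phaseSymbol
  rw [phaseTerm, mulOp_add ((BddMeas.const _).mul b1) ((BddMeas.const _).mul b2), add_apply,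
    mulOp_mul (.const _) b1, mulOp_mul (.const _) b2, mulOp_const, mulOp_const,
    restriction_eq_mulOp, restriction_eq_mulOp]
  rfl

namespace Geometry

variable (G : Geometry b c d ε)
include G

/-- Term k lives in the slots n-k and n+k+1. These differ for different k and from the slots n, n+1
of `Izero`, so at almost every point at most one term of the expansion is active. -/
theorem phaseSymbol_eq_zero {m n : ℤ} {k : ℕ+} {t : ℝ} (htd : ∀ n, t ≠ d n)
    (h1 : slotIndex c t ≠ n - (k : ℕ)) (h2 : slotIndex c t ≠ n + (k : ℕ) + 1) :
    phaseSymbol b c d m n k t = 0 := by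
  have e1 : t ∉ Iminus b c d (n - (k : ℕ)) k := fun h => h1 (G.slotIndex_of_mem_Iminus k.2 h)
  have e2 : t ∉ Iplus b c d (n + (k : ℕ)) k := fun h => h2 (G.slotIndex_of_mem_Iplus k.2 h (htd _))
  rw [phaseSymbol, Set.indicator_of_notMem e1, Set.indicator_of_notMem e2, mul_zero, mul_zero,
    add_zero]

/-- B⁺_{n-k,k} = σ(n) - σ(n-k) is exactly the shift needed in slot n-k. In slot n+k+1 the shift
B⁻_{n+k,k} = σ(n+k+1) - σ(n+1) falls short by 1/b_n, a period of the character. -/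
theorem character_mul_phaseSymbol {m n : ℤ} {k : ℕ+} {t : ℝ} (htd : ∀ n, t ≠ d n)
    (ht : t ∈ Iminus b c d (n - (k : ℕ)) k ∪ Iplus b c d (n + (k : ℕ)) k) :
    character (m * b n) t * phaseSymbol b c d m n k t
      = character (m * b n) (unshifted b c t + totalShift b n) := by
  rcases ht with ht | ht
  · have hi := G.slotIndex_of_mem_Iminus k.2 ht
    have hn : t ∉ Iplus b c d (n + (k : ℕ)) k := fun h => by
      have := G.slotIndex_of_mem_Iplus k.2 h (htd _)
      omega
    rw [phaseSymbol, Set.indicator_of_mem ht, Set.indicator_of_notMem hn, mul_zero, add_zero,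
      Pi.one_apply, mul_one, character, character, ← Complex.exp_add, unshifted, hi, Bplus_eq,
      sub_add_cancel]
    congr 1
    push_cast
    ring
  · have hi := G.slotIndex_of_mem_Iplus k.2 ht (htd _)
    have hn : t ∉ Iminus b c d (n - (k : ℕ)) k := fun h => by
      have := G.slotIndex_of_mem_Iminus k.2 h
      omega
    have hb : b n ≠ 0 := fun h => by
      have := G.shift_pos n
      simp [h] at this
    rw [phaseSymbol, Set.indicator_of_mem ht, Set.indicator_of_notMem hn, mul_zero, zero_add,
      Pi.one_apply, mul_one, unshifted, hi, Bminus_eq,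
      show n + ((k : ℕ) : ℤ) + 1 - (k : ℕ) = n + 1 by ring, totalShift_succ b n,
      show t - totalShift b (n + ((k : ℕ) : ℤ) + 1) + totalShift b n
        = t - (totalShift b (n + ((k : ℕ) : ℤ) + 1) - (totalShift b n + (b n)⁻¹)) - (b n)⁻¹ by ring,
      character_natural_shift hb, character, character, ← Complex.exp_add]
    congr 1
    push_cast
    ring

/-- All dual elements are obtained from those with `m = 0` by modulations and phase factors. -/
theorem dual_eq
    (hW : ∀ φ, BddMeas φ → ChainInvariant b c d φ → ∀ f, W (mulOp φ f) = mulOp φ (W f))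
    (hg : ∀ n, ∀ᵐ t, t ∉ Set.Icc (c n) (d n) → g n t = 0) (m n : ℤ) :
    Summable (phaseTerm b c d m n (W (gaborSystem g b (0, n)))) ∧
      W (gaborSystem g b (m, n)) = modulation (m * b n)
        (restriction (Izero c d n) (measurableSet_Izero c d n) (W (gaborSystem g b (0, n))) +
          ∑' k : ℕ+, phaseTerm b c d m n (W (gaborSystem g b (0, n))) k) := by
  set f := W (gaborSystem g b (0, n)) with hf
  have bθ : BddMeas fun t => character (m * b n) (unshifted b c t + totalShift b n) :=
    (BddMeas.character _).comp (G.measurable_unshifted.add_const _)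
  have b0 := BddMeas.indicator (measurableSet_Izero c d n)
  obtain ⟨K, hK⟩ := G.exists_forall_dual_eq_empty n
  have hfin : {k : ℕ+ | (k : ℕ) < K}.Finite := (Set.finite_lt_nat K).preimage
    PNat.coe_injective.injOn
  set F : Finset ℕ+ := hfin.toFinset with hF
  have hnF : ∀ k ∉ F, Iminus b c d (n - (k : ℕ)) k = ∅ ∧ Iplus b c d (n + (k : ℕ)) k = ∅ := by
    intro k hk
    exact hK k (by simpa [hF] using hk) k.2
  have hsum : HasSum (phaseTerm b c d m n f) (∑ k ∈ F, phaseTerm b c d m n f k) := by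
    refine hasSum_sum_of_ne_finset_zero fun k hk => ?_
    rw [phaseTerm_eq_mulOp]
    unfold phaseSymbol
    simp only [hnF k hk, Set.indicator_empty, mul_zero, add_zero]
    rw [mulOp_zero]; rfl
  refine ⟨hsum.summable, ?_⟩
  have bF : BddMeas fun t => ∑ k ∈ F, phaseSymbol b c d m n k t :=
    BddMeas.sum F fun k => bddMeas_phaseSymbol b c d m n k
  have hFsum : ∑ k ∈ F, phaseTerm b c d m n f k
      = mulOp (fun t => ∑ k ∈ F, phaseSymbol b c d m n k t) f := by
    rw [mulOp_sum F fun k => bddMeas_phaseSymbol b c d m n k, sum_apply]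
    exact Finset.sum_congr rfl fun k _ => phaseTerm_eq_mulOp b c d m n f k
  rw [hsum.tsum_eq, hFsum, G.gaborSystem_eq_mulOp_unshifted (hg n) m,
    hW _ bθ (G.chainInvariant_comp_unshifted fun x => character (m * b n) (x + totalShift b n)),
    ← hf, modulation_eq_mulOp, restriction_eq_mulOp, ← add_apply, ← mulOp_add b0 bF,
    ← mulOp_mul (.character _) (b0.add bF)]
  refine mulOp_congr bθ ((BddMeas.character _).mul (b0.add bF)) ?_
  have hsupp : ∀ᵐ t, t ∉ Set.Icc (c n) (d n) → gaborSystem g b (0, n) t = 0 := by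
    rw [gaborSystem_eq]
    filter_upwards [coeFn_mulOp (BddMeas.character (((0 : ℤ) : ℝ) * b n)) (g n), hg n]
      with t h1 h2 h3
    rw [h1, h2 h3, mul_zero]
  filter_upwards [G.vanish_off_dualSupport hW n hsupp, ae_ne_all d] with t ht htd
  by_cases hE : t ∈ Izero c d n ∪ ⋃ k : ℕ+,
      (Iminus b c d (n - (k : ℕ)) k ∪ Iplus b c d (n + (k : ℕ)) k)
  · congr 1
    rcases hE with h0 | hE
    · have hi := G.slotIndex_of_mem_Icc h0 (htd n)
      rw [Set.indicator_of_mem h0, Finset.sum_eq_zero fun k _ => ?_, add_zero, Pi.one_apply, mul_one,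
        G.character_unshifted m hi]
      have hk := k.pos
      exact G.phaseSymbol_eq_zero htd (by omega) (by omega)
    · obtain ⟨k, hk⟩ := Set.mem_iUnion.1 hE
      have hk0 := k.pos
      have hi : slotIndex c t = n - (k : ℕ) ∨ slotIndex c t = n + (k : ℕ) + 1 :=
        hk.imp (G.slotIndex_of_mem_Iminus k.2) fun h => G.slotIndex_of_mem_Iplus k.2 h (htd _)
      have h0 : t ∉ Izero c d n := fun h0 => by
        have := G.slotIndex_of_mem_Icc h0 (htd n)
        omega
      rw [Set.indicator_of_notMem h0, zero_add, Finset.sum_eq_single k,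
        G.character_mul_phaseSymbol htd hk]
      · intro k' _ hne
        have hne' : (k' : ℕ) ≠ k := fun h => hne (PNat.coe_injective h)
        have := k'.pos
        exact G.phaseSymbol_eq_zero htd (by omega) (by omega)
      · intro hkF
        obtain ⟨h1, h2⟩ := hnF k hkF
        rw [h1, h2, Set.union_empty] at hk
        exact absurd hk (Set.notMem_empty t)
  · rw [ht hE, mul_zero, mul_zero]

theorem dual_essSupport
    (hW : ∀ φ, BddMeas φ → ChainInvariant b c d φ → ∀ f, W (mulOp φ f) = mulOp φ (W f))
    (hg : ∀ n, ∀ᵐ t, t ∉ Set.Icc (c n) (d n) → g n t = 0) (m n : ℤ) :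
    essSupport (W (gaborSystem g b (m, n))) ⊆ Izero c d n ∪ ⋃ k : ℕ+,
      (Iminus b c d (n - (k : ℕ)) k ∪ Iplus b c d (n + (k : ℕ)) k) := by
  refine essSupport_subset_of_ae (G.isClosed_dualSupport n) (G.vanish_off_dualSupport hW n ?_)
  rw [gaborSystem_eq]
  filter_upwards [coeFn_mulOp (BddMeas.character (m * b n)) (g n), hg n] with t h1 h2 h3
  rw [h1, h2 h3, mul_zero]

end Geometry

end

end NSGabor

end

/-! ### Assembly of the main theorem. -/

theorem mainTheorem1
    (g : ℤ → NSGabor.L2) (b c d : ℤ → ℝ) (ε : ℝ)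
    (hframe : NSGabor.IsFrame (NSGabor.gaborSystem g b))
    (hcd : ∀ n, c n < d n)
    (hsupp : ∀ n, NSGabor.essSupport (g n) = Set.Icc (c n) (d n))
    (hb : ∀ n, 1 / (d n - c n) < b n)
    (hε : 0 < ε)
    (hoverlap : ∀ n, d (n - 1) ≤ c (n + 1))
    (hbinv : ∀ n, max (max ((d n - c n) / 2) (c (n + 1) - c n)) (d n - d (n - 1)) + ε ≤ (b n)⁻¹) :
    -- the frame operator exists and is invertible, and its inverse has properties (i), (ii), (iii)
    (∃ S : NSGabor.L2 ≃L[ℂ] NSGabor.L2,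
      NSGabor.IsFrameOperator (NSGabor.gaborSystem g b) (S : NSGabor.L2 →L[ℂ] NSGabor.L2) ∧
      -- (i)
      (∃ (ω₀ : NSGabor.Linf) (ω : NSGabor.OffDiag → NSGabor.Linf),
        NSGabor.IsWalnutLikeRepresentation (Λ := Option NSGabor.OffDiag) ⊤
          (S.symm : NSGabor.L2 →L[ℂ] NSGabor.L2)
          (fun o => o.elim ω₀ ω) (fun o => o.elim 0 (NSGabor.walnutShift b)) ∧
        ∀ p, NSGabor.essSupport (ω p) ⊆ NSGabor.walnutInterval b c d p) ∧
      -- (ii)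
      (∀ m n : ℤ, NSGabor.essSupport (S.symm (NSGabor.gaborSystem g b (m, n))) ⊆
        NSGabor.Izero c d n ∪ ⋃ k : ℕ+,
          (NSGabor.Iminus b c d (n - (k : ℕ)) k ∪ NSGabor.Iplus b c d (n + (k : ℕ)) k)) ∧
      -- (iii)
      (∀ m n : ℤ,
        Summable (NSGabor.phaseTerm b c d m n (S.symm (NSGabor.gaborSystem g b (0, n)))) ∧
        S.symm (NSGabor.gaborSystem g b (m, n)) =
          NSGabor.modulation (m * b n)
            (NSGabor.restriction (NSGabor.Izero c d n) (NSGabor.measurableSet_Izero c d n)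
                (S.symm (NSGabor.gaborSystem g b (0, n))) +
              ∑' k : ℕ+, NSGabor.phaseTerm b c d m n
                (S.symm (NSGabor.gaborSystem g b (0, n))) k))) ∧
    -- (iv)
    (∀ n : ℤ, ∃ k₀ : ℕ, 1 ≤ k₀ ∧ ∀ k : ℕ, k₀ ≤ k →
      NSGabor.Iplus b c d n k = ∅ ∧ NSGabor.Iminus b c d n k = ∅) ∧
    (∀ C : ℝ, (∀ n, d n - c n - (b n)⁻¹ ≤ C) → ∀ (n : ℤ) (k : ℕ), 1 ≤ k →
      (C / ε + 1 < k → NSGabor.Iplus b c d n k = ∅ ∧ NSGabor.Iminus b c d n k = ∅) ∧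
      (C / ε + 1 ≤ k →
        (NSGabor.Iplus b c d n k).Subsingleton ∧ (NSGabor.Iminus b c d n k).Subsingleton)) := by
  have G := NSGabor.Geometry.of_bounds hcd hb hε hoverlap hbinv
  have hg : ∀ n, ∀ᵐ t, t ∉ Set.Icc (c n) (d n) → g n t = 0 := fun n => by
    have := NSGabor.ae_eq_zero_of_notMem_essSupport (g n)
    rwa [hsupp n] at this
  have hP := G.slotProj_isOrthogonalPartition
  refine ⟨?_, G.exists_forall_eq_empty, fun C hC n k hk => ⟨fun h => ?_, fun h => ?_⟩⟩
  · obtain ⟨A, B, hA, -, hfr⟩ := hframe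
    obtain ⟨S, hS⟩ := NSGabor.exists_isFrameOperator (fun f => (hfr f).1) fun f => (hfr f).2.2
    obtain ⟨e, τ, he, hR, hN⟩ := NSGabor.exists_neumann_series hA fun f =>
      (hS.tsum_eq_re_inner f) ▸ (hfr f).2.1
    subst he
    have hW : ∀ φ, NSGabor.BddMeas φ → NSGabor.ChainInvariant b c d φ → ∀ f,
        (e.symm : NSGabor.L2 →L[ℂ] NSGabor.L2) (NSGabor.mulOp φ f)
          = NSGabor.mulOp φ ((e.symm : NSGabor.L2 →L[ℂ] NSGabor.L2) f) := by
      intro φ hφ hinv f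
      have := G.frameOperator_commute hg hS (fun f => (hfr f).1) (fun f => (hfr f).2.2) hφ hinv
        (e.symm f)
      simp only [ContinuousLinearEquiv.coe_coe, ContinuousLinearEquiv.apply_symm_apply] at this ⊢
      rw [← this, ContinuousLinearEquiv.symm_apply_apply]
    have hband : ∀ o i : ℤ, 1 < |o - i| → ∀ x, NSGabor.slotProj c o
        ((1 - τ • (e : NSGabor.L2 →L[ℂ] NSGabor.L2)) (NSGabor.slotProj c i x)) = 0 := by
      intro o i hoi x
      have hne : o ≠ i := by rintro rfl; simp at hoi
      rw [sub_apply, smul_apply, map_sub, map_smul, G.frameOperator_tridiagonal hg hS o i hoi,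
        smul_zero, sub_zero]
      exact hP.orth o i hne x
    have h₂ := G.dual_essSupport hW hg
    have h₃ := G.dual_eq hW hg
    simp only [ContinuousLinearEquiv.coe_coe] at h₂ h₃
    refine ⟨e, hS, ?_, h₂, h₃⟩
    exact G.exists_walnut hW (NSGabor.summable_pow_natAbs (norm_nonneg _) hR
      (‖τ‖ * (1 - ‖1 - τ • (e : NSGabor.L2 →L[ℂ] NSGabor.L2)‖)⁻¹))
      fun o i x => hP.norm_neumann_block_le hR hband hN o i x
  · refine G.eq_empty_of_lt hk ((hC n).trans_lt ?_)
    rw [← lt_sub_iff_add_lt, div_lt_iff₀ hε] at h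
    exact h
  · refine G.subsingleton_of_le hk ((hC n).trans ?_)
    rw [← le_sub_iff_add_le, div_le_iff₀ hε] at h
    exact h
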